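/- **Theorem (Termination).** Let $n=2f+1$ and let $\Delta>0$ be a known delay bound. There is a choice of timeouts $\tau:\mathbb N\to\mathbb R$ (one per view, depending only on $n,f,\Delta$) such that, for every set $\mathcal V$ of values, every assignment of inputs $v_i\in\mathcal V$, every set of at most $f$ Byzantine processes and every eventually synchronous execution of the algorithm below with timeouts $\tau$, every correct process eventually decides. *Communication.* Processes $0,\dots,n-1$ communicate by consistent broadcast (CB). Each process numbers its broadcasts consecutively. For correct $p,q,q'$ and any process $r$: if $p$ broadcasts $(k,m)$, then $q$ eventually delivers $(k,m)$ from $p$; $q$ delivers at most one message $(k,\cdot)$ from $r$; if $q$, $q'$ deliver $(k,m)$, $(k,m')$ from $r$, then $m=m'$; if $q$ delivers $(k,m)$ from $p$, then $p$ broadcast $(k,m)$ before; and $q$ delivers $(k,\cdot)$ from $r$ only after the earlier broadcasts of $r$ (FIFO). Byzantine processes are otherwise arbitrary, but cannot forge signatures of correct processes. Only finitely many events happen in bounded time. *Eventual synchrony.* For each execution there is a time GST, unknown to the processes, such that: a message broadcast by a correct process at time $t$ is delivered by every correct process by time $\max(t,\mathrm{GST})+\Delta$; a step of a correct process (of its main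 program, or an acknowledgement) that is enabled at time $t$ is taken by time $\max(t,\mathrm{GST})+\Delta$; and the local clocks of correct processes are nondecreasing and run at the rate of real time from GST on. Before GST there is no other restriction. *Algorithm of a correct process $i$.* Initially $view=0$, $est=aux=\bot$, $proof=\emptyset$, $vc=(0,\bot,\emptyset)$, and $i$ is undecided. Then $i$ repeats, where a timeout expires when $\tau(view)$ has elapsed on the local clock of $i$ since the wait began: 1. Let $p=view \bmod n$. If $p=i$, broadcast $\langle\mathrm{Prepare},view,init,proof\rangle$, where $init=est$ if $est\ne\bot$ and $init=v_i$ otherwise. Wait for a valid $\langle\mathrm{Prepare},view,val,P\rangle$ from $p$ or for the timeout on $p$. If a valid Prepare was received, set $aux=val$ and $vc=(view,val,P)$, otherwise $aux=\bot$. 2. Broadcast $\langle\mathrm{Commit},view,aux\rangle$. Wait until valid commits for $view$ have been received from at least $n-f$ processes and, for every process $j$, a valid commit for $view$ has been received from $j$ or the timeout on $j$ has expired. If $aux\neq\bot$, at least $n-f$ processes sent valid commits for $aux$ in $view$, and $i$ is undecided, decide $aux$. 3. Broadcast the signed message $\langle\mathrm{ViewChange},view+1,vc\rangle$. Wait for a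 set $\Psi$ of at least $n-f$ non-conflicting view-change certificates for $view+1$, from distinct senders. Set $proof=\Psi$, let $est$ be the estimate in $\Psi$ associated with the highest view ($\bot$ if all tuples carry $\bot$), and increase $view$ by $1$. In the background, whenever $i$ has delivered a valid ViewChange message $d$, it broadcasts a signed $\langle\mathrm{ViewChangeAck},d\rangle$. *Validity.* A *view-change certificate* for view $w$ is a signed ViewChange message for $w$ with at least $n-f-1$ acknowledgements of it, signed by distinct processes other than its sender. Two certificates *conflict* if their tuples carry different estimates $\ne\bot$ for the same view, both with valid proofs for views below $w$. A *valid proof* for $val\neq\bot$ in view $0$ is $\emptyset$; in view $w>0$ it is a set of at least $n-f$ non-conflicting certificates for $w$ from distinct senders such that $val$ is an estimate $\neq\bot$ of highest view among their tuples, or all their tuples carry $\bot$. A Prepare from the primary of view $w$ is *valid* if it is for $w$, its estimate is $\neq\bot$, its proof is valid for that estimate in $w$, and it is the first such message of its sender. A commit for $(w,val)$ is *valid* if its sender broadcast before it no ViewChange for a view above $w$ and no commit for $w$ with a different value. A ViewChange message of $j$ for $w+1$ with tuple $(u,val,P)$ is *valid* if before it $j$ broadcast exactly one commit for each view $\le w$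 and no other ViewChange for $w+1$, and either $val=\bot$, $(u,val,P)=(0,\bot,\emptyset)$ and all these commits are $\bot$, or $val\neq\bot$, $u\le w$ is the highest view among those of these commits that are $\ne\bot$, $j$ committed $val$ in view $u$, and $P$ is a valid proof for $val$ in $u$. ("Before" refers to the broadcast order of the sender.) -/

import Mathlib

namespace CBConsensus

universe u

/-! ### Messages

Processes are the elements of `Fin n`; `V` is the type of values; the undefined value `⊥` is `none`.
Signatures are symbolic: a term that names a signer stands for a payload together with a valid
signature of that signer. The unforgeability of the signatures of correct processes is
`Execution.Unforgeable` below. -/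

/-- The message `⟨ViewChange, view, (tupleView, tupleVal, tupleProof)⟩` signed by `sender`.
A pair `(d, qs)` in `tupleProof` is a view-change certificate: the signed message `d` together with
acknowledgements of `d` signed by the processes in `qs`. -/
structure ViewChange (n : ℕ) (V : Type u) : Type u where
  sender : Fin n
  view : ℕ
  tupleView : ℕ
  tupleVal : Option V
  tupleProof : List (ViewChange n V × List (Fin n))

/-- A view-change certificate: a signed view-change message and the signers of acknowledgements of
that message. -/
abbrev Certificate (n : ℕ) (V : Type u) : Type u := ViewChange n V × List (Fin n)

/-- The messages that processes broadcast. -/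
inductive Msg (n : ℕ) (V : Type u) : Type u
  | prepare (view : ℕ) (val : Option V) (proof : List (Certificate n V))
  | commit (view : ℕ) (val : Option V)
  | viewChange (d : ViewChange n V)
  | ack (d : ViewChange n V)

/-- `CertIn c P`: the certificate `c` occurs in the proof `P`, possibly nested. -/
inductive CertIn {n : ℕ} {V : Type u} (c : Certificate n V) : List (Certificate n V) → Prop
  | here {P : List (Certificate n V)} : c ∈ P → CertIn c P
  | nested {P : List (Certificate n V)} {c' : Certificate n V} :
      c' ∈ P → CertIn c c'.1.tupleProof → CertIn c P

/-- The certificate `c` occurs somewhere in the message. -/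
def Msg.HasCert {n : ℕ} {V : Type u} (c : Certificate n V) : Msg n V → Prop
  | .prepare _ _ P => CertIn c P
  | .commit _ _ => False
  | .viewChange d => CertIn c d.tupleProof
  | .ack d => CertIn c d.tupleProof

/-- The signed view-change message `d` occurs somewhere in the message. -/
def Msg.HasViewChange {n : ℕ} {V : Type u} (d : ViewChange n V) (m : Msg n V) : Prop :=
  m = .viewChange d ∨ m = .ack d ∨ ∃ c : Certificate n V, m.HasCert c ∧ c.1 = d

/-! ### Validity of certificates, proofs and messages -/

/-- `c` is a view-change certificate for view `w`: a view-change message for `w` and at least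
`n - f - 1` acknowledgements from distinct processes other than its sender. -/
def CertificateFor (n f : ℕ) {V : Type u} (w : ℕ) (c : Certificate n V) : Prop :=
  c.1.view = w ∧ c.2.Nodup ∧ c.1.sender ∉ c.2 ∧ n - f - 1 ≤ c.2.length

/-- Two certificates conflict if their tuples carry different estimates (both `≠ ⊥`) for the same
view, both with a valid proof; `valid u x Q` says that `Q` is a valid proof for `x` in view `u`. -/
def Conflict {n : ℕ} {V : Type u} (valid : ℕ → V → List (Certificate n V) → Prop)
    (c c' : Certificate n V) : Prop :=
  ∃ x x' : V, c.1.tupleVal = some x ∧ c'.1.tupleVal = some x' ∧ x ≠ x' ∧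
    c.1.tupleView = c'.1.tupleView ∧
    valid c.1.tupleView x c.1.tupleProof ∧ valid c'.1.tupleView x' c'.1.tupleProof

/-- `P` consists of (at least) `n - f` pairwise non-conflicting view-change certificates for view
`w`, whose view-change messages come from distinct processes. -/
def NonConflictingSet (n f : ℕ) {V : Type u} (valid : ℕ → V → List (Certificate n V) → Prop)
    (w : ℕ) (P : List (Certificate n V)) : Prop :=
  n - f ≤ P.length ∧ (P.map fun c => c.1.sender).Nodup ∧
    (∀ c ∈ P, CertificateFor n f w c) ∧ ∀ c ∈ P, ∀ c' ∈ P, ¬ Conflict valid c c'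

/-- `x` is the estimate in `P` associated with the highest view (among the estimates `≠ ⊥`). -/
def HighestEstimate {n : ℕ} {V : Type u} (P : List (Certificate n V)) (x : V) : Prop :=
  ∃ c ∈ P, c.1.tupleVal = some x ∧
    ∀ c' ∈ P, c'.1.tupleVal ≠ none → c'.1.tupleView ≤ c.1.tupleView

/-- All tuples in `P` carry `⊥`. -/
def NoEstimate {n : ℕ} {V : Type u} (P : List (Certificate n V)) : Prop :=
  ∀ c ∈ P, c.1.tupleVal = none

/-- `P` is a valid proof for the estimate `x` in view `w`. In view `0` this is the empty proof. In a
view `w > 0` it is a set of non-conflicting certificates for `w` with `x` as the estimate of the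
highest view, or without any estimate. -/
def ProofValid (n f : ℕ) {V : Type u} (w : ℕ) (x : V) (P : List (Certificate n V)) : Prop :=
  if w = 0 then P = []
  else
    NonConflictingSet n f (fun u y Q => ∃ _ : u < w, ProofValid n f u y Q) w P ∧
      (HighestEstimate P x ∨ NoEstimate P)
termination_by w

/-- `P` is a set of `n - f` non-conflicting view-change certificates for view `w`. -/
def ViewChangeProof (n f : ℕ) {V : Type u} (w : ℕ) (P : List (Certificate n V)) : Prop :=
  NonConflictingSet n f (fun u y Q => ∃ _ : u < w, ProofValid n f u y Q) w P

/-- In the sequence `L` of messages of one sender, in the order of broadcast, the message number `a`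
is a valid `⟨Prepare, w, x, P⟩`, and it is the first one for view `w`. -/
def FirstValidPrepare (n f : ℕ) {V : Type u} (L : List (Msg n V)) (w a : ℕ) (x : V)
    (P : List (Certificate n V)) : Prop :=
  L[a]? = some (.prepare w (some x) P) ∧ ProofValid n f w x P ∧
    ∀ b < a, ∀ (y : V) (Q : List (Certificate n V)),
      L[b]? = some (.prepare w (some y) Q) → ¬ ProofValid n f w y Q

/-- The sequence `L` of messages of one sender contains a valid `⟨Commit, w, x⟩`: the sender sent
before it neither a view change to a view above `w` nor a different commit for `w`. -/
def HasValidCommit {n : ℕ} {V : Type u} (L : List (Msg n V)) (w : ℕ) (x : Option V) : Prop :=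
  ∃ a : ℕ, L[a]? = some (Msg.commit w x) ∧
    (∀ b < a, ∀ d : ViewChange n V, L[b]? = some (Msg.viewChange d) → d.view ≤ w) ∧
    ∀ b < a, ∀ y : Option V, L[b]? = some (Msg.commit w y) → y = x

/-- In the sequence `L` of messages of the sender `j`, the message number `a` is the valid
view-change message `d`: before it, `j` sent exactly one commit for each view `≤ w` (where `d` is
for view `w + 1`) and no other view change for view `w + 1`; the tuple matches the commit `≠ ⊥` of
the highest view, with a valid proof, and is `(0, ⊥, ∅)` if all these commits are `⊥`. -/
def ViewChangeValid (n f : ℕ) {V : Type u} (j : Fin n) (L : List (Msg n V)) (a : ℕ)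
    (d : ViewChange n V) : Prop :=
  L[a]? = some (.viewChange d) ∧ d.sender = j ∧
  ∃ w, d.view = w + 1 ∧
    (∀ u ≤ w, ∃! b, b < a ∧ ∃ y : Option V, L[b]? = some (.commit u y)) ∧
    (∀ b < a, ∀ d' : ViewChange n V, L[b]? = some (.viewChange d') → d'.view ≠ d.view) ∧
    ((d.tupleVal = none ∧ d.tupleView = 0 ∧ d.tupleProof = [] ∧
        ∀ u ≤ w, ∀ b < a, ∀ y : Option V, L[b]? = some (.commit u y) → y = none) ∨
      ∃ x : V, d.tupleVal = some x ∧ d.tupleView ≤ w ∧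
        (∃ b < a, L[b]? = some (.commit d.tupleView (some x))) ∧
        (∀ u, d.tupleView < u → u ≤ w →
          ∀ b < a, ∀ y : Option V, L[b]? = some (.commit u y) → y = none) ∧
        ProofValid n f d.tupleView x d.tupleProof)

/-! ### The algorithm of a correct process -/

/-- Control points of the main loop: the top of the loop and its three `wait until` statements. -/
inductive Phase
  | top
  | waitPrepare
  | waitCommit
  | waitViewChange

/-- The local state of a process. `(vcView, vcVal, vcProof)` is its view-change tuple and `decision`
is the decided value, if any. `timer` is the time at which the current wait started; `out` lists the
messages that the process has broadcast, the `k`-th entry being its broadcast number `k`;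
`inbox p` lists the messages that it has delivered from `p`; `acked` holds the pairs `(j, k)` such
that it has acknowledged message number `k` of `j`. -/
structure LocalState (n : ℕ) (V : Type u) where
  phase : Phase
  view : ℕ
  est : Option V
  aux : Option V
  proof : List (Certificate n V)
  vcView : ℕ
  vcVal : Option V
  vcProof : List (Certificate n V)
  decision : Option V
  timer : ℝ
  out : List (Msg n V)
  inbox : Fin n → List (Msg n V)
  acked : Set (Fin n × ℕ)

/-- The state in which `propose` starts. -/
def LocalState.initial (n : ℕ) (V : Type u) : LocalState n V where
  phase := .top
  view := 0
  est := none
  aux := none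
  proof := []
  vcView := 0
  vcVal := none
  vcProof := []
  decision := none
  timer := 0
  out := []
  inbox := fun _ => []
  acked := ∅

namespace LocalState

variable {n : ℕ} {V : Type u}

/-- The process can accept the estimate `x` with proof `P` from the primary of its view. -/
def Accepts (f : ℕ) (s : LocalState n V) (x : V) (P : List (Certificate n V)) : Prop :=
  ∃ p : Fin n, p.val = s.view % n ∧ ∃ a : ℕ, FirstValidPrepare n f (s.inbox p) s.view a x P

/-- The condition of the wait in the second phase; `expired` says that the timeout has expired. -/
def CommitsComplete (f : ℕ) (s : LocalState n V) (expired : Prop) : Prop :=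
  (∃ Q : Finset (Fin n), n - f ≤ Q.card ∧ ∀ j ∈ Q, ∃ x, HasValidCommit (s.inbox j) s.view x) ∧
    ∀ j : Fin n, (∃ x, HasValidCommit (s.inbox j) s.view x) ∨ expired

/-- At least `n - f` processes sent a valid commit for `aux` in the current view. -/
def CommitQuorum (f : ℕ) (s : LocalState n V) : Prop :=
  ∃ Q : Finset (Fin n), n - f ≤ Q.card ∧ ∀ j ∈ Q, HasValidCommit (s.inbox j) s.view s.aux

open Classical in
/-- The value of `decision` after the decision test of the second phase: a decision is never
changed, and nothing is decided if `aux = ⊥` or if there is no quorum for `aux`. -/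
noncomputable def decide (f : ℕ) (s : LocalState n V) : Option V :=
  match s.decision with
  | some y => some y
  | none => if s.CommitQuorum f then s.aux else none

/-- All parts of the certificate `c` have been delivered. -/
def ReceivedCert (s : LocalState n V) (c : Certificate n V) : Prop :=
  .viewChange c.1 ∈ s.inbox c.1.sender ∧ ∀ q ∈ c.2, .ack c.1 ∈ s.inbox q

/-- One step of the main loop of process `i` with input `v` at time `now`: from the top of the loop
or a satisfied wait to the next wait or the top of the next iteration. A timeout set in view `w`
expires `τ w` units of the local clock after the wait began. -/
def MainStep (f : ℕ) (τ : ℕ → ℝ) (clock : ℝ → ℝ) (i : Fin n) (v : V) (now : ℝ)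
    (s s' : LocalState n V) : Prop :=
  match s.phase with
  | .top =>
      s' = { s with
        phase := .waitPrepare
        timer := now
        out := s.out ++
          if s.view % n = i.val then [.prepare s.view (some (s.est.getD v)) s.proof] else [] }
  | .waitPrepare =>
      (∃ (x : V) (P : List (Certificate n V)), s.Accepts f x P ∧
        s' = { s with
          phase := .waitCommit
          timer := now
          aux := some x
          vcView := s.view
          vcVal := some x
          vcProof := P
          out := s.out ++ [.commit s.view (some x)] }) ∨
      ((¬ ∃ (x : V) (P : List (Certificate n V)), s.Accepts f x P) ∧
        τ s.view ≤ clock now - clock s.timer ∧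
        s' = { s with
          phase := .waitCommit
          timer := now
          aux := none
          out := s.out ++ [.commit s.view none] })
  | .waitCommit =>
      s.CommitsComplete f (τ s.view ≤ clock now - clock s.timer) ∧
        s' = { s with
          phase := .waitViewChange
          decision := s.decide f
          out := s.out ++ [.viewChange ⟨i, s.view + 1, s.vcView, s.vcVal, s.vcProof⟩] }
  | .waitViewChange =>
      ∃ (P : List (Certificate n V)) (e : Option V),
        ViewChangeProof n f (s.view + 1) P ∧ (∀ c ∈ P, s.ReceivedCert c) ∧
        ((e = none ∧ NoEstimate P) ∨ ∃ x, e = some x ∧ HighestEstimate P x) ∧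
        s' = { s with
          phase := .top
          proof := P
          est := e
          view := s.view + 1 }

/-- Message number `a` of `j` is the valid view-change message `d`, has been delivered and has not
been acknowledged yet. -/
def PendingAck (f : ℕ) (s : LocalState n V) (j : Fin n) (a : ℕ) (d : ViewChange n V) : Prop :=
  ViewChangeValid n f j (s.inbox j) a d ∧ (j, a) ∉ s.acked

end LocalState

/-! ### Executions -/

/-- `deliver q p a m`: `q` delivers `m` as broadcast number `a` of `p`. `main i`: a step of the main
loop of `i`. `ack i j a`: the background task of `i` acknowledges message number `a` of `j`.
`idle`: something that does not change the local state of a correct process. -/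
inductive Event (n : ℕ) (V : Type u) : Type u
  | deliver (q p : Fin n) (a : ℕ) (m : Msg n V)
  | main (i : Fin n)
  | ack (i j : Fin n) (a : ℕ)
  | idle

/-- The effect of an event at time `now` on the local states of the processes. Only events at correct
processes are recorded; Byzantine processes act through the messages that are delivered from them.
The condition on `a` in a delivery says that instances of one sender are delivered in FIFO order,
and each at most once. -/
def Step {n : ℕ} {V : Type u} (f : ℕ) (τ : ℕ → ℝ) (input : Fin n → V) (correct : Finset (Fin n))
    (clock : Fin n → ℝ → ℝ) (now : ℝ) (c c' : Fin n → LocalState n V) : Event n V → Prop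
  | .deliver q p a m => q ∈ correct ∧ a = ((c q).inbox p).length ∧
      c' = Function.update c q
        { c q with inbox := Function.update (c q).inbox p ((c q).inbox p ++ [m]) }
  | .main i => i ∈ correct ∧ ∃ s', (c i).MainStep f τ (clock i) i (input i) now s' ∧
      c' = Function.update c i s'
  | .ack i j a => i ∈ correct ∧ ∃ d, (c i).PendingAck f j a d ∧
      c' = Function.update c i
        { c i with out := (c i).out ++ [.ack d], acked := insert (j, a) (c i).acked }
  | .idle => c' = c

/-- A timed sequence of configurations: `config k` is reached at `time k`, and `event k` leads from
`config k` to `config (k + 1)` and happens at `time (k + 1)`. -/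
structure Execution (n : ℕ) (V : Type u) where
  time : ℕ → ℝ
  config : ℕ → Fin n → LocalState n V
  event : ℕ → Event n V

namespace Execution

variable {n : ℕ} {V : Type u}

/-- The correct processes run the algorithm with timeouts `τ`, and only finitely many events happen
in a bounded time. -/
structure Follows (E : Execution n V) (f : ℕ) (τ : ℕ → ℝ) (input : Fin n → V)
    (correct : Finset (Fin n)) (clock : Fin n → ℝ → ℝ) : Prop where
  start : ∀ i ∈ correct, E.config 0 i = LocalState.initial n V
  step : ∀ k, Step f τ input correct clock (E.time (k + 1)) (E.config k) (E.config (k + 1))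
    (E.event k)
  time_mono : Monotone E.time
  time_unbounded : Filter.Tendsto E.time Filter.atTop Filter.atTop

/-- The defining properties of consistent broadcast, for each instance `(p, a)` (broadcast number
`a` of sender `p`); that a process delivers at most one message per instance, in FIFO order, is part
of `Step`. -/
structure ConsistentBroadcast (E : Execution n V) (correct : Finset (Fin n)) : Prop where
  validity : ∀ p ∈ correct, ∀ q ∈ correct, ∀ (k a : ℕ) (m : Msg n V),
    (E.config k p).out[a]? = some m → ∃ k', ((E.config k' q).inbox p)[a]? = some m
  consistency : ∀ q ∈ correct, ∀ q' ∈ correct, ∀ (p : Fin n) (k k' a : ℕ) (m m' : Msg n V),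
    ((E.config k q).inbox p)[a]? = some m → ((E.config k' q').inbox p)[a]? = some m' → m = m'
  integrity : ∀ p ∈ correct, ∀ q ∈ correct, ∀ (k a : ℕ) (m : Msg n V),
    ((E.config k q).inbox p)[a]? = some m → (E.config k p).out[a]? = some m

/-- Every signature of a correct process that occurs in a delivered message was produced by that
process before. -/
structure Unforgeable (E : Execution n V) (correct : Finset (Fin n)) : Prop where
  viewChange : ∀ q ∈ correct, ∀ (p : Fin n) (k : ℕ), ∀ m ∈ (E.config k q).inbox p,
    ∀ d : ViewChange n V, m.HasViewChange d → d.sender ∈ correct →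
      .viewChange d ∈ (E.config k d.sender).out
  ack : ∀ q ∈ correct, ∀ (p : Fin n) (k : ℕ), ∀ m ∈ (E.config k q).inbox p,
    ∀ c : Certificate n V, m.HasCert c → ∀ r ∈ c.2, r ∈ correct →
      .ack c.1 ∈ (E.config k r).out

/-- From time `gst` on, communication delays and processing delays are at most `Δ`, and the local
clocks of correct processes run at the rate of real time. What is pending at time `gst` is completed
by `gst + Δ`. Before `gst` there is no bound, and clocks are only monotone. -/
structure SynchronousAfter (E : Execution n V) (f : ℕ) (τ : ℕ → ℝ) (input : Fin n → V)
    (correct : Finset (Fin n)) (clock : Fin n → ℝ → ℝ) (Δ gst : ℝ) : Prop where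
  clock_mono : ∀ i ∈ correct, Monotone (clock i)
  clock_rate : ∀ i ∈ correct, ∀ s t, gst ≤ s → s ≤ t → clock i t - clock i s = t - s
  communication : ∀ p ∈ correct, ∀ q ∈ correct, ∀ (k a : ℕ) (m : Msg n V),
    (E.config k p).out[a]? = some m →
      ∃ k', E.time k' ≤ max (E.time k) gst + Δ ∧ ((E.config k' q).inbox p)[a]? = some m
  main_delay : ∀ i ∈ correct, ∀ (k : ℕ) (t : ℝ), E.time k ≤ t → t ≤ E.time (k + 1) →
    (∃ s', (E.config k i).MainStep f τ (clock i) i (input i) t s') →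
      ∃ k' ≥ k, E.event k' = .main i ∧ E.time (k' + 1) ≤ max t gst + Δ
  ack_delay : ∀ i ∈ correct, ∀ (k : ℕ) (j : Fin n) (a : ℕ) (d : ViewChange n V),
    (E.config k i).PendingAck f j a d →
      ∃ k' ≥ k, E.event k' = .ack i j a ∧ E.time (k' + 1) ≤ max (E.time k) gst + Δ

end Execution

end CBConsensus

/-!
Every step of the main loop of a correct process raises its *rank* (four times the view plus the
position in the loop) by one, and the messages of a correct process other than acknowledgements are
broadcast in the order of their ranks. An invariant of the local state (`LocalInv`) then shows that
the prepares, commits and view changes of correct processes are valid in the sense of the receivers.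

Let `G` be at least the global stabilization time and the starting time. If all correct processes
have entered view `v` by time `T ≥ G`, they have all entered view `v + 1` by
`T + 2 * τ v + 8 * Δ` (`Execution.Timely.pass_view`). The first two waits end by the timeouts, since
the commits of the `n - f` correct processes arrive. For the third wait, the view changes of the
correct processes, acknowledged by the correct processes, are a set of `n - f` certificates. They do
not conflict: an estimate of view `u` in such a view change is one that its sender accepted from the
primary of view `u`, and by the consistency of the broadcast all correct processes find the same
first valid proposal there (`Execution.Timely.not_conflict`).

With `τ v = (9 * 3 ^ v - 4) * Δ` these bounds sum to `G + 9 * (3 ^ v - 1) * Δ = G + τ v - 5 * Δ` for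
entering view `v`. So the timeouts catch up with any lag between the correct processes: take a view
`v` with a correct primary that no correct process has entered by time `G`. There, no timeout
expires before `G + τ v`, whereas all correct processes are in view `v` by `G + τ v - 5 * Δ`.
Hence all of them accept the proposal of the primary, commit its estimate
(`Execution.Timely.commit_eq`), and receive the commits of all correct processes before they leave
the second wait, where they decide (`Execution.Timely.decision_ne_none`).
-/

namespace CBConsensus

variable {n f : ℕ} {V : Type*}

/-! ### Ranks and the order of the broadcasts of one process -/

/-- The position of a control point in an iteration of the main loop. -/
def Phase.index : Phase → ℕ
  | .top => 0
  | .waitPrepare => 1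
  | .waitCommit => 2
  | .waitViewChange => 3

/-- The number of main-loop steps that lead to the state: an iteration has four steps. -/
def LocalState.rank (s : LocalState n V) : ℕ := 4 * s.view + s.phase.index

/-- The rank of the state of a correct process right after it broadcasts the message.
Acknowledgements come from the background task and have no rank. The subtraction is harmless: a
view change of a correct process is for a positive view. -/
def Msg.rank : Msg n V → Option ℕ
  | .prepare w _ _ => some (4 * w + 1)
  | .commit w _ => some (4 * w + 2)
  | .viewChange d => some (4 * d.view - 1)
  | .ack _ => none

/-- The ranks of the messages (other than acknowledgements) increase strictly along `L`. -/
def Ordered (L : List (Msg n V)) : Prop :=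
  L.Pairwise fun m m' => ∀ r ∈ m.rank, ∀ r' ∈ m'.rank, r < r'

theorem Ordered.lt {L : List (Msg n V)} (h : Ordered L) {a b : ℕ} {m m' : Msg n V} {r r' : ℕ}
    (hab : a < b) (ha : L[a]? = some m) (hb : L[b]? = some m') (hr : m.rank = some r)
    (hr' : m'.rank = some r') : r < r' := by
  obtain ⟨ha', rfl⟩ := List.getElem?_eq_some_iff.1 ha
  obtain ⟨hb', rfl⟩ := List.getElem?_eq_some_iff.1 hb
  exact List.pairwise_iff_getElem.1 h a b ha' hb' hab r hr r' hr'

theorem Ordered.index_eq {L : List (Msg n V)} (h : Ordered L) {a b : ℕ} {m m' : Msg n V} {r : ℕ}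
    (ha : L[a]? = some m) (hb : L[b]? = some m') (hr : m.rank = some r)
    (hr' : m'.rank = some r) : a = b := by
  rcases lt_trichotomy a b with hab | hab | hab
  · exact absurd (h.lt hab ha hb hr hr') (lt_irrefl _)
  · exact hab
  · exact absurd (h.lt hab hb ha hr' hr) (lt_irrefl _)

theorem Ordered.hasValidCommit {L : List (Msg n V)} (h : Ordered L) {w : ℕ} {x : Option V}
    (hx : .commit w x ∈ L) : HasValidCommit L w x := by
  obtain ⟨a, ha⟩ := List.mem_iff_getElem?.1 hx
  refine ⟨a, ha, fun b hb d hd => ?_, fun b hb y hy => ?_⟩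
  · have := h.lt hb hd ha rfl rfl
    omega
  · exact absurd (h.lt hb hy ha rfl rfl) (lt_irrefl _)

theorem Ordered.append_singleton {L : List (Msg n V)} (h : Ordered L) {m : Msg n V}
    (hm : ∀ m' ∈ L, ∀ r ∈ m'.rank, ∀ r' ∈ m.rank, r < r') : Ordered (L ++ [m]) := by
  refine List.pairwise_append.2 ⟨h, List.pairwise_singleton _ _, ?_⟩
  simpa using hm

theorem HasValidCommit.mem {L : List (Msg n V)} {w : ℕ} {x : Option V}
    (h : HasValidCommit L w x) : .commit w x ∈ L := by
  obtain ⟨a, ha, -⟩ := h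
  exact List.mem_iff_getElem?.2 ⟨a, ha⟩

/-! ### Predicates that depend only on an initial segment -/

theorem getElem?_eq_of_prefix {α : Type*} {L L' : List α} (h : L <+: L') {a b : ℕ} {m : α}
    (ha : L[a]? = some m) (hb : b ≤ a) : L'[b]? = L[b]? := by
  obtain ⟨t, rfl⟩ := h
  have := (List.getElem?_eq_some_iff.1 ha).1
  exact List.getElem?_append_left (by omega)

theorem getElem?_of_prefix {α : Type*} {L L' : List α} (h : L <+: L') {a : ℕ} {m : α}
    (ha : L[a]? = some m) : L'[a]? = some m := by
  rw [getElem?_eq_of_prefix h ha le_rfl, ha]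

theorem FirstValidPrepare.congr {L L' : List (Msg n V)} {w a : ℕ} {x : V}
    {P : List (Certificate n V)} (h : FirstValidPrepare n f L w a x P)
    (hL : ∀ b ≤ a, L'[b]? = L[b]?) : FirstValidPrepare n f L' w a x P := by
  obtain ⟨h1, h2, h3⟩ := h
  refine ⟨by rw [hL a le_rfl, h1], h2, fun b hb y Q hy => h3 b hb y Q ?_⟩
  rw [← hL b hb.le, hy]

theorem FirstValidPrepare.of_prefix {L L' : List (Msg n V)} {w a : ℕ} {x : V}
    {P : List (Certificate n V)} (h : FirstValidPrepare n f L w a x P) (hL : L <+: L') :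
    FirstValidPrepare n f L' w a x P :=
  h.congr fun _ hb => getElem?_eq_of_prefix hL h.1 hb

/-- Two processes whose logs of the primary agree accept the same estimate. -/
theorem FirstValidPrepare.unique {L L' : List (Msg n V)} {w a a' : ℕ} {x x' : V}
    {P P' : List (Certificate n V)} (h : FirstValidPrepare n f L w a x P)
    (h' : FirstValidPrepare n f L' w a' x' P')
    (hL : ∀ (b : ℕ) (m m' : Msg n V), L[b]? = some m → L'[b]? = some m' → m = m') : x = x' := by
  have key : ∀ {L L' : List (Msg n V)} {a a' : ℕ} {x x' : V} {P P' : List (Certificate n V)},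
      FirstValidPrepare n f L w a x P → FirstValidPrepare n f L' w a' x' P' →
      (∀ (b : ℕ) (m m' : Msg n V), L[b]? = some m → L'[b]? = some m' → m = m') → ¬ a < a' := by
    intro L L' a a' x x' P P' h h' hL hlt
    have hlen := (List.getElem?_eq_some_iff.1 h'.1).1
    have hb : L'[a]? = some L'[a] := List.getElem?_eq_getElem (hlt.trans hlen)
    rw [← hL _ _ _ h.1 hb] at hb
    exact h'.2.2 a hlt x P hb h.2.1
  obtain rfl : a = a' := by
    have h1 := key h h' hL
    have h2 := key h' h fun b m m' hm hm' => (hL b m' m hm' hm).symm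
    omega
  have := hL _ _ _ h.1 h'.1
  simp only [Msg.prepare.injEq, Option.some.injEq] at this
  exact this.2.1

theorem ViewChangeValid.congr {j : Fin n} {L L' : List (Msg n V)} {a : ℕ} {d : ViewChange n V}
    (h : ViewChangeValid n f j L a d) (hL : ∀ b ≤ a, L'[b]? = L[b]?) :
    ViewChangeValid n f j L' a d := by
  obtain ⟨h1, h2, w, h3, h4, h5, h6⟩ := h
  refine ⟨by rw [hL a le_rfl, h1], h2, w, h3, fun u hu => ?_, fun b hb d' hd' => ?_, ?_⟩
  · obtain ⟨b, ⟨hb, y, hy⟩, hun⟩ := h4 u hu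
    refine ⟨b, ⟨hb, y, by rw [hL b hb.le, hy]⟩, ?_⟩
    rintro b' ⟨hb', y', hy'⟩
    exact hun b' ⟨hb', y', by rw [← hL b' hb'.le, hy']⟩
  · exact h5 b hb d' (by rw [← hL b hb.le, hd'])
  · refine h6.imp ?_ ?_
    · rintro ⟨e1, e2, e3, e4⟩
      exact ⟨e1, e2, e3, fun u hu b hb y hy => e4 u hu b hb y (by rw [← hL b hb.le, hy])⟩
    · rintro ⟨x, e1, e2, ⟨b, hb, hbx⟩, e4, e5⟩
      exact ⟨x, e1, e2, ⟨b, hb, by rw [hL b hb.le, hbx]⟩,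
        fun u hu hu' b hb y hy => e4 u hu hu' b hb y (by rw [← hL b hb.le, hy]), e5⟩

theorem ViewChangeValid.of_prefix {j : Fin n} {L L' : List (Msg n V)} {a : ℕ}
    {d : ViewChange n V} (h : ViewChangeValid n f j L a d) (hL : L <+: L') :
    ViewChangeValid n f j L' a d :=
  h.congr fun _ hb => getElem?_eq_of_prefix hL h.1 hb

/-! ### The invariant of a correct process -/

/-- What holds of the local state `s` of a correct process `i` with input `v` at all times. -/
structure LocalInv (f : ℕ) (i : Fin n) (v : V) (s : LocalState n V) : Prop where
  rank_le : ∀ m ∈ s.out, ∀ r ∈ m.rank, r ≤ s.rank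
  ordered : Ordered s.out
  proof_valid : ProofValid n f s.view (s.est.getD v) s.proof
  prepare : ∀ w, 4 * w + 1 ≤ s.rank → i.val = w % n →
    ∃ a x P, FirstValidPrepare n f s.out w a x P
  commit : ∀ w, 4 * w + 2 ≤ s.rank → ∃ y, .commit w y ∈ s.out
  commit_aux : 2 ≤ s.phase.index → .commit s.view s.aux ∈ s.out
  accepted : ∀ w x, .commit w (some x) ∈ s.out →
    ∃ p : Fin n, p.val = w % n ∧ ∃ a P, FirstValidPrepare n f (s.inbox p) w a x P
  tuple : (s.vcVal = none ∧ s.vcView = 0 ∧ s.vcProof = [] ∧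
      ∀ w y, .commit w y ∈ s.out → y = none) ∨
    ∃ x, s.vcVal = some x ∧ .commit s.vcView (some x) ∈ s.out ∧
      (∀ w y, s.vcView < w → .commit w y ∈ s.out → y = none) ∧
      ProofValid n f s.vcView x s.vcProof
  viewChange : ∀ w, 4 * w + 3 ≤ s.rank →
    ∃ a d, ViewChangeValid n f i s.out a d ∧ d.view = w + 1
  acked : ∀ j a, (j, a) ∈ s.acked →
    ∃ d, (s.inbox j)[a]? = some (.viewChange d) ∧ .ack d ∈ s.out

theorem LocalInv.initial (i : Fin n) (v : V) : LocalInv f i v (LocalState.initial n V) := by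
  constructor <;>
    simp [LocalState.initial, LocalState.rank, Phase.index, Ordered, ProofValid]

theorem LocalInv.deliver {i : Fin n} {v : V} {s : LocalState n V} (h : LocalInv f i v s)
    (p : Fin n) (m : Msg n V) :
    LocalInv f i v { s with inbox := Function.update s.inbox p (s.inbox p ++ [m]) } := by
  have hpre : ∀ q, s.inbox q <+: Function.update s.inbox p (s.inbox p ++ [m]) q := by
    intro q
    by_cases hq : q = p
    · subst hq; simp
    · simp [hq]
  exact { h with
    accepted := fun w x hx => by
      obtain ⟨q, hq, a, P, hP⟩ := h.accepted w x hx
      exact ⟨q, hq, a, P, hP.of_prefix (hpre q)⟩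
    acked := fun j a hja => by
      obtain ⟨d, hd, hd'⟩ := h.acked j a hja
      exact ⟨d, getElem?_of_prefix (hpre j) hd, hd'⟩ }

theorem LocalInv.ack {i : Fin n} {v : V} {s : LocalState n V} (h : LocalInv f i v s)
    {j : Fin n} {a : ℕ} {d : ViewChange n V} (hd : s.PendingAck f j a d) :
    LocalInv f i v
      { s with out := s.out ++ [.ack d], acked := insert (j, a) s.acked } where
  rank_le m hm r hmr := by
    rcases List.mem_append.1 hm with hm | hm
    · exact h.rank_le m hm r hmr
    · simp only [List.mem_singleton] at hm
      subst hm
      simp [Msg.rank] at hmr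
  ordered := h.ordered.append_singleton (by simp [Msg.rank])
  proof_valid := h.proof_valid
  prepare w hw hi := by
    obtain ⟨a, x, P, hP⟩ := h.prepare w hw hi
    exact ⟨a, x, P, hP.of_prefix (List.prefix_append _ _)⟩
  commit w hw := by
    obtain ⟨y, hy⟩ := h.commit w hw
    exact ⟨y, List.mem_append_left _ hy⟩
  commit_aux := by simpa using h.commit_aux
  accepted := by simpa using h.accepted
  tuple := by simpa using h.tuple
  viewChange w hw := by
    obtain ⟨a, d, hP, hd⟩ := h.viewChange w hw
    exact ⟨a, d, hP.of_prefix (List.prefix_append _ _), hd⟩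
  acked j' a' hja := by
    rcases hja with hja | hja
    · cases hja
      exact ⟨d, hd.1.1, by simp⟩
    · obtain ⟨d, hd, hd'⟩ := h.acked j' a' hja
      exact ⟨d, hd, by simp [hd']⟩

theorem LocalState.MainStep.rank_eq {τ : ℕ → ℝ} {clock : ℝ → ℝ} {i : Fin n} {v : V} {now : ℝ}
    {s s' : LocalState n V} (h : s.MainStep f τ clock i v now s') : s'.rank = s.rank + 1 := by
  cases hp : s.phase <;> simp only [LocalState.MainStep, hp] at h
  · subst h; simp [LocalState.rank, Phase.index, hp]
  · rcases h with ⟨x, P, -, rfl⟩ | ⟨-, -, rfl⟩ <;> simp [LocalState.rank, Phase.index, hp]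
  · obtain ⟨-, rfl⟩ := h; simp [LocalState.rank, Phase.index, hp]
  · obtain ⟨P, e, -, -, -, rfl⟩ := h; simp [LocalState.rank, Phase.index, hp]; ring

theorem LocalInv.top {i : Fin n} {v : V} {s : LocalState n V} (h : LocalInv f i v s)
    (hp : s.phase = .top) (now : ℝ) :
    LocalInv f i v { s with
      phase := .waitPrepare
      timer := now
      out := s.out ++
        if s.view % n = i.val then [.prepare s.view (some (s.est.getD v)) s.proof] else [] } := by
  have hr : s.rank = 4 * s.view := by simp [LocalState.rank, hp, Phase.index]
  have hle := h.rank_le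
  rw [hr] at hle
  constructor
  · intro m hm r hmr
    simp only [LocalState.rank, Phase.index]
    rcases List.mem_append.1 hm with hm | hm
    · have := hle m hm r hmr
      omega
    · split_ifs at hm
      · simp only [List.mem_singleton] at hm
        subst hm
        simp only [Msg.rank, Option.mem_def, Option.some.injEq] at hmr
        omega
      · simp at hm
  · show Ordered (s.out ++ _)
    split_ifs
    · refine h.ordered.append_singleton fun m hm r hmr r' hr' => ?_
      have := hle m hm r hmr
      simp only [Msg.rank, Option.mem_def, Option.some.injEq] at hr'
      omega
    · simpa using h.ordered
  · exact h.proof_valid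
  · intro w hw hi
    simp only [LocalState.rank, Phase.index] at hw
    rcases Nat.lt_or_ge w s.view with hlt | hge
    · obtain ⟨a, x, P, hP⟩ := h.prepare w (by omega) hi
      exact ⟨a, x, P, hP.of_prefix (List.prefix_append _ _)⟩
    · obtain rfl : w = s.view := by omega
      refine ⟨s.out.length, s.est.getD v, s.proof, ?_, h.proof_valid, fun b hb y Q hy => ?_⟩
      · simp [hi]
      · simp only [List.getElem?_append_left hb] at hy
        have := hle _ (List.mem_of_getElem? hy) _ rfl
        omega
  · intro w hw
    simp only [LocalState.rank, Phase.index] at hw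
    obtain ⟨y, hy⟩ := h.commit w (by omega)
    exact ⟨y, List.mem_append_left _ hy⟩
  · simp [Phase.index]
  all_goals
    have hc : ∀ w (y : Option V), .commit w y ∈ s.out ++
        (if s.view % n = i.val then
          [Msg.prepare s.view (some (s.est.getD v)) s.proof] else []) ↔ .commit w y ∈ s.out := by
      intro w y
      split_ifs <;> simp
  · simpa only [hc] using h.accepted
  · simpa only [hc] using h.tuple
  · intro w hw
    simp only [LocalState.rank, Phase.index] at hw
    obtain ⟨a, d, hP, hd⟩ := h.viewChange w (by omega)
    exact ⟨a, d, hP.of_prefix (List.prefix_append _ _), hd⟩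
  · intro j a hja
    obtain ⟨d, hd, hd'⟩ := h.acked j a hja
    exact ⟨d, hd, List.mem_append_left _ hd'⟩

/-- The invariant after the first wait, whether a proposal has been accepted (`y = some x`) or the
timeout has expired (`y = none`). -/
theorem LocalInv.waitPrepare {i : Fin n} {v : V} {s : LocalState n V} (h : LocalInv f i v s)
    (hp : s.phase = .waitPrepare) (now : ℝ) (y : Option V) (u : ℕ) (z : Option V)
    (R : List (Certificate n V))
    (hy : (y = none ∧ u = s.vcView ∧ z = s.vcVal ∧ R = s.vcProof) ∨
      ∃ x, y = some x ∧ u = s.view ∧ z = some x ∧ s.Accepts f x R) :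
    LocalInv f i v { s with
      phase := .waitCommit
      timer := now
      aux := y
      vcView := u
      vcVal := z
      vcProof := R
      out := s.out ++ [.commit s.view y] } := by
  have hr : s.rank = 4 * s.view + 1 := by simp [LocalState.rank, hp, Phase.index]
  have hle := h.rank_le
  rw [hr] at hle
  constructor
  · intro m hm r hmr
    simp only [LocalState.rank, Phase.index]
    rcases List.mem_append.1 hm with hm | hm
    · have := hle m hm r hmr
      omega
    · simp only [List.mem_singleton] at hm
      subst hm
      simp only [Msg.rank, Option.mem_def, Option.some.injEq] at hmr
      omega
  · refine h.ordered.append_singleton fun m hm r hmr r' hr' => ?_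
    have := hle m hm r hmr
    simp only [Msg.rank, Option.mem_def, Option.some.injEq] at hr'
    omega
  · exact h.proof_valid
  · intro w hw hi
    simp only [LocalState.rank, Phase.index] at hw
    obtain ⟨a, x, P, hP⟩ := h.prepare w (by omega) hi
    exact ⟨a, x, P, hP.of_prefix (List.prefix_append _ _)⟩
  · intro w hw
    simp only [LocalState.rank, Phase.index] at hw
    rcases Nat.lt_or_ge w s.view with hlt | hge
    · obtain ⟨y, hy⟩ := h.commit w (by omega)
      exact ⟨y, List.mem_append_left _ hy⟩
    · obtain rfl : w = s.view := by omega
      exact ⟨y, by simp⟩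
  · simp
  · intro w x hx
    simp only [List.mem_append, List.mem_singleton, Msg.commit.injEq] at hx
    rcases hx with hx | ⟨rfl, rfl⟩
    · exact h.accepted w x hx
    · rcases hy with ⟨hy, -⟩ | ⟨x', hx', -, -, p, hp, a, hP⟩
      · cases hy
      · cases hx'
        exact ⟨p, hp, a, R, hP⟩
  · simp only [List.mem_append, List.mem_singleton, Msg.commit.injEq]
    rcases hy with ⟨rfl, rfl, rfl, rfl⟩ | ⟨x, rfl, rfl, rfl, p, hp, a, hP⟩
    · rcases h.tuple with ⟨h1, h2, h3, h4⟩ | ⟨x, h1, h2, h3, h4⟩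
      · refine Or.inl ⟨h1, h2, h3, fun w y hy => ?_⟩
        rcases hy with hy | hy
        · exact h4 w y hy
        · exact hy.2
      · refine Or.inr ⟨x, h1, Or.inl h2, fun w y hw hy => ?_, h4⟩
        rcases hy with hy | hy
        · exact h3 w y hw hy
        · exact hy.2
    · refine Or.inr ⟨x, rfl, Or.inr ⟨rfl, rfl⟩, fun w y hw hy => ?_, hP.2.1⟩
      rcases hy with hy | hy
      · have := hle _ hy _ rfl
        omega
      · omega
  · intro w hw
    simp only [LocalState.rank, Phase.index] at hw
    obtain ⟨a, d, hP, hd⟩ := h.viewChange w (by omega)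
    exact ⟨a, d, hP.of_prefix (List.prefix_append _ _), hd⟩
  · intro j a hja
    obtain ⟨d, hd, hd'⟩ := h.acked j a hja
    exact ⟨d, hd, List.mem_append_left _ hd'⟩

/-- The view-change message sent after the second wait is valid. -/
theorem LocalInv.viewChangeValid {i : Fin n} {v : V} {s : LocalState n V} (h : LocalInv f i v s)
    (hp : s.phase = .waitCommit) :
    ViewChangeValid n f i
      (s.out ++ [.viewChange ⟨i, s.view + 1, s.vcView, s.vcVal, s.vcProof⟩]) s.out.length
      ⟨i, s.view + 1, s.vcView, s.vcVal, s.vcProof⟩ := by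
  have hr : s.rank = 4 * s.view + 2 := by simp [LocalState.rank, hp, Phase.index]
  have hle := h.rank_le
  rw [hr] at hle
  have hget : ∀ b < s.out.length, ∀ L : List (Msg n V), (s.out ++ L)[b]? = s.out[b]? :=
    fun b hb L => List.getElem?_append_left hb
  refine ⟨by simp, rfl, s.view, rfl, fun u hu => ?_, fun b hb d' hd' hv => ?_, ?_⟩
  · obtain ⟨y, hy⟩ := h.commit u (by omega)
    obtain ⟨b, hb⟩ := List.mem_iff_getElem?.1 hy
    have hlt := (List.getElem?_eq_some_iff.1 hb).1
    refine ⟨b, ⟨hlt, y, by rw [hget b hlt, hb]⟩, ?_⟩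
    rintro b' ⟨hlt', y', hy'⟩
    rw [hget b' hlt'] at hy'
    exact h.ordered.index_eq hy' hb rfl rfl
  · rw [hget b hb] at hd'
    have := hle _ (List.mem_of_getElem? hd') _ rfl
    simp only at hv
    omega
  · rcases h.tuple with ⟨h1, h2, h3, h4⟩ | ⟨x, h1, h2, h3, h4⟩
    · refine Or.inl ⟨h1, h2, h3, fun u hu b hb y hy => ?_⟩
      rw [hget b hb] at hy
      exact h4 u y (List.mem_of_getElem? hy)
    · obtain ⟨b, hb⟩ := List.mem_iff_getElem?.1 h2
      have hlt := (List.getElem?_eq_some_iff.1 hb).1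
      have := hle _ h2 _ rfl
      refine Or.inr ⟨x, h1, by simp only; omega, ⟨b, hlt, by rw [hget b hlt, hb]⟩,
        fun u hu hu' b hb y hy => ?_, h4⟩
      rw [hget b hb] at hy
      exact h3 u y hu (List.mem_of_getElem? hy)

theorem LocalInv.waitCommit {i : Fin n} {v : V} {s : LocalState n V} (h : LocalInv f i v s)
    (hp : s.phase = .waitCommit) (δ : Option V) :
    LocalInv f i v { s with
      phase := .waitViewChange
      decision := δ
      out := s.out ++ [.viewChange ⟨i, s.view + 1, s.vcView, s.vcVal, s.vcProof⟩] } := by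
  have hr : s.rank = 4 * s.view + 2 := by simp [LocalState.rank, hp, Phase.index]
  have hle := h.rank_le
  rw [hr] at hle
  constructor
  · intro m hm r hmr
    simp only [LocalState.rank, Phase.index]
    rcases List.mem_append.1 hm with hm | hm
    · have := hle m hm r hmr
      omega
    · simp only [List.mem_singleton] at hm
      subst hm
      simp only [Msg.rank, Option.mem_def, Option.some.injEq] at hmr
      omega
  · refine h.ordered.append_singleton fun m hm r hmr r' hr' => ?_
    have := hle m hm r hmr
    simp only [Msg.rank, Option.mem_def, Option.some.injEq] at hr'
    omega
  · exact h.proof_valid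
  · intro w hw hi
    simp only [LocalState.rank, Phase.index] at hw
    obtain ⟨a, x, P, hP⟩ := h.prepare w (by omega) hi
    exact ⟨a, x, P, hP.of_prefix (List.prefix_append _ _)⟩
  · intro w hw
    simp only [LocalState.rank, Phase.index] at hw
    obtain ⟨y, hy⟩ := h.commit w (by omega)
    exact ⟨y, List.mem_append_left _ hy⟩
  · intro _
    exact List.mem_append_left _ (h.commit_aux (by simp [hp, Phase.index]))
  · simpa using h.accepted
  · simpa using h.tuple
  · intro w hw
    simp only [LocalState.rank, Phase.index] at hw
    rcases Nat.lt_or_ge w s.view with hlt | hge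
    · obtain ⟨a, d, hP, hd⟩ := h.viewChange w (by omega)
      exact ⟨a, d, hP.of_prefix (List.prefix_append _ _), hd⟩
    · obtain rfl : w = s.view := by omega
      exact ⟨_, _, h.viewChangeValid hp, rfl⟩
  · intro j a hja
    obtain ⟨d, hd, hd'⟩ := h.acked j a hja
    exact ⟨d, hd, List.mem_append_left _ hd'⟩

theorem LocalInv.waitViewChange {i : Fin n} {v : V} {s : LocalState n V} (h : LocalInv f i v s)
    (hp : s.phase = .waitViewChange) {P : List (Certificate n V)} {e : Option V}
    (hP : ViewChangeProof n f (s.view + 1) P)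
    (he : (e = none ∧ NoEstimate P) ∨ ∃ x, e = some x ∧ HighestEstimate P x) :
    LocalInv f i v { s with
      phase := .top
      proof := P
      est := e
      view := s.view + 1 } := by
  have hr : s.rank = 4 * s.view + 3 := by simp [LocalState.rank, hp, Phase.index]
  have hr' : ∀ r, r ≤ s.rank → r ≤ 4 * (s.view + 1) + 0 := by omega
  exact { h with
    rank_le := fun m hm r hmr => hr' r (h.rank_le m hm r hmr)
    proof_valid := by
      rw [ProofValid, if_neg (Nat.succ_ne_zero _)]
      refine ⟨hP, ?_⟩
      rcases he with ⟨-, he⟩ | ⟨x, rfl, hx⟩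
      · exact Or.inr he
      · exact Or.inl hx
    prepare := fun w hw => h.prepare w (by simp only [LocalState.rank, Phase.index] at hw; omega)
    commit := fun w hw => h.commit w (by simp only [LocalState.rank, Phase.index] at hw; omega)
    commit_aux := by simp [Phase.index]
    viewChange := fun w hw =>
      h.viewChange w (by simp only [LocalState.rank, Phase.index] at hw; omega) }

theorem LocalInv.main {τ : ℕ → ℝ} {clock : ℝ → ℝ} {i : Fin n} {v : V} {now : ℝ}
    {s s' : LocalState n V} (h : LocalInv f i v s) (hs : s.MainStep f τ clock i v now s') :
    LocalInv f i v s' := by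
  cases hp : s.phase <;> simp only [LocalState.MainStep, hp] at hs
  · subst hs
    exact h.top hp now
  · rcases hs with ⟨x, P, hP, rfl⟩ | ⟨-, -, rfl⟩
    · exact h.waitPrepare hp now _ _ _ _ (Or.inr ⟨x, rfl, rfl, rfl, hP⟩)
    · exact h.waitPrepare hp now _ _ _ _ (Or.inl ⟨rfl, rfl, rfl, rfl⟩)
  · obtain ⟨-, rfl⟩ := hs
    exact h.waitCommit hp _
  · obtain ⟨P, e, hP, -, he, rfl⟩ := hs
    exact h.waitViewChange hp hP he

/-! ### Effects of one step of the main loop -/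

theorem LocalState.rank_eq_iff (s : LocalState n V) (v : ℕ) :
    (s.rank = 4 * v ↔ s.phase = .top ∧ s.view = v) ∧
    (s.rank = 4 * v + 1 ↔ s.phase = .waitPrepare ∧ s.view = v) ∧
    (s.rank = 4 * v + 2 ↔ s.phase = .waitCommit ∧ s.view = v) ∧
    (s.rank = 4 * v + 3 ↔ s.phase = .waitViewChange ∧ s.view = v) := by
  cases hp : s.phase <;> simp only [LocalState.rank, hp, Phase.index] <;>
    refine ⟨?_, ?_, ?_, ?_⟩ <;> simp <;> omega

namespace LocalState.MainStep

variable {τ : ℕ → ℝ} {clock : ℝ → ℝ} {i : Fin n} {v : V} {now : ℝ} {s s' : LocalState n V}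

theorem out_prefix (h : s.MainStep f τ clock i v now s') : s.out <+: s'.out := by
  cases hp : s.phase <;> simp only [LocalState.MainStep, hp] at h
  · subst h; simp
  · rcases h with ⟨x, P, -, rfl⟩ | ⟨-, -, rfl⟩ <;> simp
  · obtain ⟨-, rfl⟩ := h; simp
  · obtain ⟨P, e, -, -, -, rfl⟩ := h; simp

theorem inbox_eq (h : s.MainStep f τ clock i v now s') : s'.inbox = s.inbox := by
  cases hp : s.phase <;> simp only [LocalState.MainStep, hp] at h
  · subst h; rfl
  · rcases h with ⟨x, P, -, rfl⟩ | ⟨-, -, rfl⟩ <;> rfl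
  · obtain ⟨-, rfl⟩ := h; rfl
  · obtain ⟨P, e, -, -, -, rfl⟩ := h; rfl

theorem timer_eq (h : s.MainStep f τ clock i v now s')
    (hs : s'.phase = .waitPrepare ∨ s'.phase = .waitCommit) : s'.timer = now := by
  cases hp : s.phase <;> simp only [LocalState.MainStep, hp] at h
  · subst h; rfl
  · rcases h with ⟨x, P, -, rfl⟩ | ⟨-, -, rfl⟩ <;> rfl
  · obtain ⟨-, rfl⟩ := h; simp at hs
  · obtain ⟨P, e, -, -, -, rfl⟩ := h; simp at hs

theorem decision_ne_none (h : s.MainStep f τ clock i v now s') (hs : s.decision ≠ none) :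
    s'.decision ≠ none := by
  cases hp : s.phase <;> simp only [LocalState.MainStep, hp] at h
  · subst h; exact hs
  · rcases h with ⟨x, P, -, rfl⟩ | ⟨-, -, rfl⟩ <;> exact hs
  · obtain ⟨-, rfl⟩ := h
    obtain ⟨y, hy⟩ := Option.ne_none_iff_exists'.1 hs
    simp [LocalState.decide, hy]
  · obtain ⟨P, e, -, -, -, rfl⟩ := h; exact hs

/-- Where a commit comes from. -/
theorem commit_mem (h : s.MainStep f τ clock i v now s') {w : ℕ} {y : Option V}
    (hy : .commit w y ∈ s'.out) : .commit w y ∈ s.out ∨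
      s.phase = .waitPrepare ∧ s.view = w ∧ ((∃ x P, s.Accepts f x P ∧ y = some x) ∨
        ((¬ ∃ x P, s.Accepts f x P) ∧ τ s.view ≤ clock now - clock s.timer)) := by
  cases hp : s.phase <;> simp only [LocalState.MainStep, hp] at h
  · subst h
    left
    simp only [List.mem_append] at hy
    refine hy.resolve_right ?_
    split_ifs <;> simp
  · rcases h with ⟨x, P, hP, rfl⟩ | ⟨hP, ht, rfl⟩ <;>
      simp only [List.mem_append, List.mem_singleton, Msg.commit.injEq] at hy <;>
      rcases hy with hy | ⟨rfl, rfl⟩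
    · exact Or.inl hy
    · exact Or.inr ⟨rfl, rfl, Or.inl ⟨x, P, hP, rfl⟩⟩
    · exact Or.inl hy
    · exact Or.inr ⟨rfl, rfl, Or.inr ⟨hP, ht⟩⟩
  · obtain ⟨-, rfl⟩ := h; left; simpa using hy
  · obtain ⟨P, e, -, -, -, rfl⟩ := h; exact Or.inl hy

end LocalState.MainStep

/-! ### Evolution of a correct process in an execution -/

namespace Execution

variable {E : Execution n V} {τ : ℕ → ℝ} {input : Fin n → V} {correct : Finset (Fin n)}
  {clock : Fin n → ℝ → ℝ} {Δ G : ℝ}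

namespace Follows

theorem step_cases (h : E.Follows f τ input correct clock) (i : Fin n) (k : ℕ) :
    E.config (k + 1) i = E.config k i ∨
    (∃ p m, E.config (k + 1) i = { E.config k i with
      inbox := Function.update (E.config k i).inbox p ((E.config k i).inbox p ++ [m]) }) ∨
    (∃ j a d, (E.config k i).PendingAck f j a d ∧ E.config (k + 1) i = { E.config k i with
      out := (E.config k i).out ++ [.ack d]
      acked := insert (j, a) (E.config k i).acked }) ∨
    (E.config k i).MainStep f τ (clock i) i (input i) (E.time (k + 1)) (E.config (k + 1) i) := by
  have hs := h.step k
  rcases he : E.event k with ⟨q, p, a, m⟩ | ⟨j⟩ | ⟨q, j, a⟩ | _ <;> rw [he] at hs <;>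
    simp only [Step] at hs
  · obtain ⟨-, -, hc⟩ := hs
    by_cases hq : i = q
    · subst hq; rw [hc]; simp only [Function.update_self]; exact Or.inr (Or.inl ⟨p, m, rfl⟩)
    · rw [hc]; simp [hq]
  · obtain ⟨-, s', hm, hc⟩ := hs
    by_cases hq : i = j
    · subst hq; rw [hc]; simp only [Function.update_self]; exact Or.inr (Or.inr (Or.inr hm))
    · rw [hc]; simp [hq]
  · obtain ⟨-, d, hd, hc⟩ := hs
    by_cases hq : i = q
    · subst hq; rw [hc]; simp only [Function.update_self]
      exact Or.inr (Or.inr (Or.inl ⟨j, a, d, hd, rfl⟩))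
    · rw [hc]; simp [hq]
  · rw [hs]; exact Or.inl rfl

theorem localInv (h : E.Follows f τ input correct clock) {i : Fin n} (hi : i ∈ correct) (k : ℕ) :
    LocalInv f i (input i) (E.config k i) := by
  induction k with
  | zero => rw [h.start i hi]; exact LocalInv.initial i _
  | succ k ih =>
    rcases h.step_cases i k with hk | ⟨p, m, hk⟩ | ⟨j, a, d, hd, hk⟩ | hk
    · rw [hk]; exact ih
    · rw [hk]; exact ih.deliver p m
    · rw [hk]; exact ih.ack hd
    · exact ih.main hk

theorem out_prefix (h : E.Follows f τ input correct clock) (i : Fin n)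
    {k k' : ℕ} (hk : k ≤ k') : (E.config k i).out <+: (E.config k' i).out := by
  induction hk with
  | refl => exact List.prefix_rfl
  | @step m _ ih =>
    refine ih.trans ?_
    rcases h.step_cases i m with hk | ⟨p, m, hk⟩ | ⟨j, a, d, hd, hk⟩ | hk
    · rw [hk]
    · rw [hk]
    · rw [hk]; exact List.prefix_append _ _
    · exact hk.out_prefix

theorem inbox_prefix (h : E.Follows f τ input correct clock) (i : Fin n)
    {k k' : ℕ} (hk : k ≤ k') (q : Fin n) :
    (E.config k i).inbox q <+: (E.config k' i).inbox q := by
  induction hk with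
  | refl => exact List.prefix_rfl
  | @step m _ ih =>
    refine ih.trans ?_
    rcases h.step_cases i m with hk | ⟨p, m, hk⟩ | ⟨j, a, d, hd, hk⟩ | hk
    · rw [hk]
    · rw [hk]
      by_cases hq : q = p
      · subst hq; simp
      · simp [hq]
    · rw [hk]
    · rw [hk.inbox_eq]

theorem rank_mono (h : E.Follows f τ input correct clock) (i : Fin n)
    {k k' : ℕ} (hk : k ≤ k') : (E.config k i).rank ≤ (E.config k' i).rank := by
  induction hk with
  | refl => exact le_rfl
  | @step m _ ih =>
    refine ih.trans ?_
    rcases h.step_cases i m with hk | ⟨p, m, hk⟩ | ⟨j, a, d, hd, hk⟩ | hk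
    · rw [hk]
    · rw [hk]; exact le_rfl
    · rw [hk]; exact le_rfl
    · rw [hk.rank_eq]; exact Nat.le_succ _

/-- The timer of a waiting process shows the time at which it reached its present rank. -/
theorem timer_spec (h : E.Follows f τ input correct clock) {i : Fin n} (hi : i ∈ correct) (k : ℕ)
    (hp : (E.config k i).phase = .waitPrepare ∨ (E.config k i).phase = .waitCommit) :
    ∃ k' ≤ k, (E.config k i).timer = E.time k' ∧
      (E.config k' i).rank = (E.config k i).rank ∧
      ∀ k'' < k', (E.config k'' i).rank < (E.config k i).rank := by
  induction k with
  | zero => rw [h.start i hi] at hp; simp [LocalState.initial] at hp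
  | succ k ih =>
    have keep : ∀ {s : LocalState n V}, E.config (k + 1) i = s →
        s.phase = (E.config k i).phase → s.view = (E.config k i).view →
        s.timer = (E.config k i).timer →
        ∃ k' ≤ k + 1, (E.config (k + 1) i).timer = E.time k' ∧
          (E.config k' i).rank = (E.config (k + 1) i).rank ∧
          ∀ k'' < k', (E.config k'' i).rank < (E.config (k + 1) i).rank := by
      rintro s rfl h1 h2 h3
      rw [h1] at hp
      obtain ⟨k', hk', e1, e2, e3⟩ := ih hp
      have hr : (E.config (k + 1) i).rank = (E.config k i).rank := by
        simp [LocalState.rank, h1, h2]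
      exact ⟨k', by omega, by rw [h3, e1], by rw [hr, e2], by rwa [hr]⟩
    rcases h.step_cases i k with hk | ⟨p, m, hk⟩ | ⟨j, a, d, hd, hk⟩ | hk
    · exact keep hk rfl rfl rfl
    · exact keep hk rfl rfl rfl
    · exact keep hk rfl rfl rfl
    · refine ⟨k + 1, le_rfl, hk.timer_eq hp, rfl, fun k'' hk'' => ?_⟩
      have := h.rank_mono i (Nat.lt_succ_iff.1 hk'')
      rw [hk.rank_eq]
      omega

end Follows

/-! ### The configuration at a given time -/

/-- The index of the last configuration reached by time `T`. If time is unbounded and the execution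
has started by time `T`, then the supremum is a maximum. -/
noncomputable def last (E : Execution n V) (T : ℝ) : ℕ := sSup {k | E.time k ≤ T}

namespace Follows

theorem le_last (h : E.Follows f τ input correct clock) {T : ℝ} {k : ℕ} (hk : E.time k ≤ T) :
    k ≤ E.last T := by
  obtain ⟨K, hK⟩ := (h.time_unbounded.eventually_gt_atTop T).exists
  refine le_csSup ⟨K, fun k' hk' => ?_⟩ hk
  by_contra! hlt
  exact absurd (h.time_mono hlt.le) (not_le.2 (lt_of_le_of_lt hk' hK))

theorem time_last_le (h : E.Follows f τ input correct clock) {T : ℝ} (hT : E.time 0 ≤ T) :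
    E.time (E.last T) ≤ T := by
  obtain ⟨K, hK⟩ := (h.time_unbounded.eventually_gt_atTop T).exists
  refine Nat.sSup_mem (s := {k | E.time k ≤ T}) ⟨0, hT⟩ ⟨K, fun k' hk' => ?_⟩
  by_contra! hlt
  exact absurd (h.time_mono hlt.le) (not_le.2 (lt_of_le_of_lt hk' hK))

theorem lt_time_succ_last (h : E.Follows f τ input correct clock) (T : ℝ) :
    T < E.time (E.last T + 1) := by
  by_contra! hle
  have := h.le_last hle
  omega

theorem last_le (h : E.Follows f τ input correct clock) {T : ℝ} (hT : E.time 0 ≤ T) {k : ℕ}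
    (hk : T < E.time (k + 1)) : E.last T ≤ k := by
  by_contra! hlt
  exact absurd (h.time_mono hlt) (not_le.2 (lt_of_le_of_lt (h.time_last_le hT) hk))

theorem last_mono (h : E.Follows f τ input correct clock) {T T' : ℝ} (hT : E.time 0 ≤ T)
    (hTT' : T ≤ T') : E.last T ≤ E.last T' :=
  h.le_last ((h.time_last_le hT).trans hTT')

end Follows

/-- The state of process `i` at time `T`. -/
noncomputable def stateAt (E : Execution n V) (T : ℝ) (i : Fin n) : LocalState n V :=
  E.config (E.last T) i

/-! ### Progress in the synchronous period -/

theorem SynchronousAfter.mono {gst gst' : ℝ}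
    (h : E.SynchronousAfter f τ input correct clock Δ gst) (hg : gst ≤ gst') :
    E.SynchronousAfter f τ input correct clock Δ gst' where
  clock_mono := h.clock_mono
  clock_rate i hi s t hs hst := h.clock_rate i hi s t (hg.trans hs) hst
  communication p hp q hq k a m hm := by
    obtain ⟨k', hk', hm'⟩ := h.communication p hp q hq k a m hm
    exact ⟨k', hk'.trans (by gcongr), hm'⟩
  main_delay i hi k t h1 h2 hs := by
    obtain ⟨k', hk', he, ht⟩ := h.main_delay i hi k t h1 h2 hs
    exact ⟨k', hk', he, ht.trans (by gcongr)⟩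
  ack_delay i hi k j a d hd := by
    obtain ⟨k', hk', he, ht⟩ := h.ack_delay i hi k j a d hd
    exact ⟨k', hk', he, ht.trans (by gcongr)⟩

/-- An execution of the algorithm, under a bound `G` on the global stabilization time that is not
before the start of the execution. -/
structure Timely (E : Execution n V) (f : ℕ) (τ : ℕ → ℝ) (input : Fin n → V)
    (correct : Finset (Fin n)) (clock : Fin n → ℝ → ℝ) (Δ G : ℝ) : Prop where
  follows : E.Follows f τ input correct clock
  broadcast : E.ConsistentBroadcast correct
  sync : E.SynchronousAfter f τ input correct clock Δ G
  start_le : E.time 0 ≤ G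
  delay_nonneg : 0 ≤ Δ

theorem ConsistentBroadcast.inbox_prefix_out (h : E.ConsistentBroadcast correct) {p q : Fin n}
    (hp : p ∈ correct) (hq : q ∈ correct) (k : ℕ) :
    (E.config k q).inbox p <+: (E.config k p).out :=
  List.prefix_iff_getElem?.2 fun _ ha =>
    h.integrity p hp q hq k _ _ (List.getElem?_eq_getElem ha)

namespace Timely

variable {T : ℝ} {i : Fin n}

theorem rank_mono (h : E.Timely f τ input correct clock Δ G) (i : Fin n) (hT : G ≤ T)
    {T' : ℝ} (hTT' : T ≤ T') : (E.stateAt T i).rank ≤ (E.stateAt T' i).rank :=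
  h.follows.rank_mono i (h.follows.last_mono (h.start_le.trans hT) hTT')

theorem delivered (h : E.Timely f τ input correct clock Δ G) (hT : G ≤ T) {p q : Fin n}
    (hp : p ∈ correct) (hq : q ∈ correct) {a : ℕ} {m : Msg n V}
    (hm : (E.stateAt T p).out[a]? = some m) :
    ((E.stateAt (T + Δ) q).inbox p)[a]? = some m := by
  obtain ⟨k, hk, hm'⟩ := h.sync.communication p hp q hq _ a m hm
  have hle := h.follows.time_last_le (h.start_le.trans hT)
  have : E.time k ≤ T + Δ := hk.trans (by gcongr; exact max_le hle hT)
  exact getElem?_of_prefix (h.follows.inbox_prefix q (h.follows.le_last this) p) hm'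

theorem delivered_mem (h : E.Timely f τ input correct clock Δ G) (hT : G ≤ T) {p q : Fin n}
    (hp : p ∈ correct) (hq : q ∈ correct) {m : Msg n V} (hm : m ∈ (E.stateAt T p).out) :
    m ∈ (E.stateAt (T + Δ) q).inbox p := by
  obtain ⟨a, ha⟩ := List.mem_iff_getElem?.1 hm
  exact List.mem_iff_getElem?.2 ⟨a, h.delivered hT hp hq ha⟩

/-- A process whose next step is enabled at time `T` takes it by time `T + Δ`. -/
theorem progress (h : E.Timely f τ input correct clock Δ G) (hi : i ∈ correct) (hT : G ≤ T)
    {r : ℕ} (hr : r ≤ (E.stateAt T i).rank)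
    (hs : (E.stateAt T i).rank = r →
      ∃ s', (E.stateAt T i).MainStep f τ (clock i) i (input i) T s') :
    r + 1 ≤ (E.stateAt (T + Δ) i).rank := by
  rcases hr.lt_or_eq with hlt | heq
  · exact (Nat.succ_le_of_lt hlt).trans
      (h.rank_mono i hT (le_add_of_nonneg_right h.delay_nonneg))
  · have h0 := h.start_le.trans hT
    obtain ⟨k, hk, he, ht⟩ := h.sync.main_delay i hi _ T (h.follows.time_last_le h0)
      (h.follows.lt_time_succ_last T).le (hs heq.symm)
    rw [max_eq_left hT] at ht
    have h1 := h.follows.step k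
    rw [he] at h1
    obtain ⟨-, s', hm, hc⟩ := h1
    have h2 : (E.config (k + 1) i).rank = (E.config k i).rank + 1 := by
      rw [hc, Function.update_self, hm.rank_eq]
    have h3 := h.follows.rank_mono i hk
    have h4 := h.follows.rank_mono i (h.follows.le_last ht)
    simp only [stateAt] at heq ⊢
    omega

/-- A timer that was started by time `T` has expired at time `T + τ v`, whatever the clock did
before `G`. -/
theorem expired (h : E.Timely f τ input correct clock Δ G) (hi : i ∈ correct) (hT : G ≤ T)
    {r k : ℕ} (hr : r ≤ (E.stateAt T i).rank) (hk : (E.config k i).rank = r)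
    (hp : (E.config k i).phase = .waitPrepare ∨ (E.config k i).phase = .waitCommit) {δ : ℝ}
    (hδ : 0 ≤ δ) : δ ≤ clock i (T + δ) - clock i (E.config k i).timer := by
  obtain ⟨k', hk', e1, e2, e3⟩ := h.follows.timer_spec hi k hp
  have hle : E.time k' ≤ T := by
    by_contra! hlt
    have h1 : E.last T < k' := by
      by_contra! hle
      exact absurd ((h.follows.time_mono hle).trans
        (h.follows.time_last_le (h.start_le.trans hT))) (not_le.2 hlt)
    have := e3 _ h1
    simp only [stateAt] at hr
    omega
  have h1 := h.sync.clock_mono i hi hle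
  have h2 := h.sync.clock_rate i hi T (T + δ) hT (by linarith)
  rw [e1]
  linarith

/-- The timer of a process that has left its rank at time `G` behind was started after `G`, and its
clock measures real time. -/
theorem le_time_of_expired (h : E.Timely f τ input correct clock Δ G) (hi : i ∈ correct) {k : ℕ}
    (hk : (E.stateAt G i).rank < (E.config k i).rank)
    (hp : (E.config k i).phase = .waitPrepare ∨ (E.config k i).phase = .waitCommit) {δ : ℝ}
    (hδ : δ ≤ clock i (E.time (k + 1)) - clock i (E.config k i).timer) :
    G + δ ≤ E.time (k + 1) := by
  obtain ⟨k', hk', e1, e2, e3⟩ := h.follows.timer_spec hi k hp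
  have hlt : E.last G < k' := by
    by_contra! hle
    have := h.follows.rank_mono i hle
    simp only [stateAt] at hk
    omega
  have hG : G < E.time k' := by
    by_contra! hle
    have := h.follows.le_last hle
    omega
  have h1 := h.sync.clock_rate i hi _ (E.time (k + 1)) hG.le (h.follows.time_mono (by omega))
  rw [e1] at hδ
  linarith

/-- The view changes of correct processes do not conflict: an estimate of view `u` that a correct
process reports is the first valid proposal of the primary of view `u`. -/
theorem not_conflict (h : E.Timely f τ input correct clock Δ G) {j j' : Fin n}
    (hj : j ∈ correct) (hj' : j' ∈ correct) {k a a' : ℕ} {d d' : ViewChange n V}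
    (hd : ViewChangeValid n f j (E.config k j).out a d)
    (hd' : ViewChangeValid n f j' (E.config k j').out a' d') {qs qs' : List (Fin n)}
    (valid : ℕ → V → List (Certificate n V) → Prop) : ¬ Conflict valid (d, qs) (d', qs') := by
  rintro ⟨x, x', hx, hx', hne, hview, -⟩
  have key : ∀ {j : Fin n} {a : ℕ} {d : ViewChange n V} {x : V}, j ∈ correct →
      ViewChangeValid n f j (E.config k j).out a d → d.tupleVal = some x →
      ∃ p : Fin n, p.val = d.tupleView % n ∧
        ∃ a P, FirstValidPrepare n f ((E.config k j).inbox p) d.tupleView a x P := by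
    intro j a d x hj hd hx
    obtain ⟨-, -, w, -, -, -, ⟨h1, -⟩ | ⟨y, h1, -, ⟨b, -, hb⟩, -⟩⟩ := hd
    · rw [hx] at h1; cases h1
    · rw [hx] at h1; cases h1
      exact (h.follows.localInv hj k).accepted _ _ (List.mem_of_getElem? hb)
  obtain ⟨p, hp, b, P, hP⟩ := key hj hd hx
  obtain ⟨p', hp', b', P', hP'⟩ := key hj' hd' hx'
  simp only at hview
  obtain rfl : p = p' := by ext; rw [hp, hp', hview]
  rw [← hview] at hP'
  exact hne (hP.unique hP' fun b m m' => h.broadcast.consistency j hj j' hj' p k k b m m')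

/-- Every correct process acknowledges every valid view change of a correct process. -/
theorem acknowledged (h : E.Timely f τ input correct clock Δ G) (hT : G ≤ T) {j : Fin n}
    (hi : i ∈ correct) (hj : j ∈ correct) {a : ℕ} {d : ViewChange n V}
    (hd : ViewChangeValid n f j (E.stateAt T j).out a d) :
    .ack d ∈ (E.stateAt (T + Δ + Δ) i).out := by
  have hΔ := h.delay_nonneg
  have hT1 : G ≤ T + Δ := by linarith
  have h0 := h.start_le.trans hT1
  have hin := h.delivered hT hj hi hd.1
  have hval : ViewChangeValid n f j ((E.stateAt (T + Δ) i).inbox j) a d := by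
    have h1 := hd.of_prefix (h.follows.out_prefix j
      (h.follows.last_mono (T' := T + Δ) (h.start_le.trans hT) (by linarith)))
    exact h1.congr fun b hb =>
      (getElem?_eq_of_prefix (h.broadcast.inbox_prefix_out hj hi _) hin hb).symm
  by_cases hack : (j, a) ∈ (E.stateAt (T + Δ) i).acked
  · obtain ⟨d', hd', hmem⟩ := (h.follows.localInv hi _).acked j a hack
    simp only [stateAt] at hin
    rw [hd'] at hin
    cases hin
    exact (h.follows.out_prefix i (h.follows.last_mono h0 (by linarith))).subset hmem
  · obtain ⟨k, hk, he, ht⟩ := h.sync.ack_delay i hi _ j a d ⟨hval, hack⟩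
    have h1 := h.follows.step k
    rw [he] at h1
    obtain ⟨-, d', hd', hc⟩ := h1
    have h2 := hd'.1.1
    rw [getElem?_of_prefix (h.follows.inbox_prefix i hk j) hin] at h2
    cases h2
    have h3 : Msg.ack d ∈ (E.config (k + 1) i).out := by
      rw [hc, Function.update_self]; simp
    refine (h.follows.out_prefix i (h.follows.le_last (ht.trans ?_))).subset h3
    gcongr
    exact max_le (h.follows.time_last_le h0) hT1

end Timely

theorem exists_estimate (P : List (Certificate n V)) :
    ∃ e : Option V, (e = none ∧ NoEstimate P) ∨ ∃ x, e = some x ∧ HighestEstimate P x := by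
  by_cases hP : NoEstimate P
  · exact ⟨none, Or.inl ⟨rfl, hP⟩⟩
  · simp only [NoEstimate, not_forall] at hP
    obtain ⟨c₀, hc₀, hne⟩ := hP
    have hfin : {c | c ∈ P ∧ c.1.tupleVal ≠ none}.Finite :=
      (List.finite_toSet P).subset fun _ h => h.1
    obtain ⟨c, ⟨hc, hcne⟩, hmax⟩ :=
      Set.exists_max_image _ (fun c => c.1.tupleView) hfin ⟨c₀, hc₀, hne⟩
    obtain ⟨x, hx⟩ := Option.ne_none_iff_exists'.1 hcne
    exact ⟨some x, Or.inr ⟨x, rfl, c, hc, hx, fun c' hc' h => hmax c' ⟨hc', h⟩⟩⟩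

namespace Timely

variable {T : ℝ} {v : ℕ}

/-! ### Passing one view -/

theorem pass_top (h : E.Timely f τ input correct clock Δ G) (hT : G ≤ T)
    (hr : ∀ i ∈ correct, 4 * v ≤ (E.stateAt T i).rank) :
    ∀ i ∈ correct, 4 * v + 1 ≤ (E.stateAt (T + Δ) i).rank := by
  refine fun i hi => h.progress hi hT (hr i hi) fun heq => ?_
  have hp := (((E.stateAt T i).rank_eq_iff v).1.1 heq).1
  simp [LocalState.MainStep, hp]

theorem pass_waitPrepare (h : E.Timely f τ input correct clock Δ G) (hT : G ≤ T)
    (hτ : 0 ≤ τ v) (hr : ∀ i ∈ correct, 4 * v + 1 ≤ (E.stateAt T i).rank) :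
    ∀ i ∈ correct, 4 * v + 2 ≤ (E.stateAt (T + τ v + Δ) i).rank := by
  intro i hi
  have hT' : T ≤ T + τ v := by linarith
  refine h.progress hi (hT.trans hT') ((hr i hi).trans (h.rank_mono i hT hT')) fun heq => ?_
  obtain ⟨hp, hv⟩ := ((E.stateAt (T + τ v) i).rank_eq_iff v).2.1.1 heq
  have hex := h.expired hi hT (hr i hi) heq (Or.inl hp) hτ
  simp only [LocalState.MainStep, hp]
  by_cases hacc : ∃ x P, (E.stateAt (T + τ v) i).Accepts f x P
  · obtain ⟨x, P, hP⟩ := hacc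
    exact ⟨_, Or.inl ⟨x, P, hP, rfl⟩⟩
  · refine ⟨_, Or.inr ⟨hacc, ?_, rfl⟩⟩
    rw [hv]
    exact hex

/-- The commits of the correct processes are delivered as valid commits. -/
theorem validCommit_delivered (h : E.Timely f τ input correct clock Δ G) (hT : G ≤ T)
    (hr : ∀ i ∈ correct, 4 * v + 2 ≤ (E.stateAt T i).rank) {i j : Fin n} (hi : i ∈ correct)
    (hj : j ∈ correct) {k : ℕ} (hk : E.last (T + Δ) ≤ k) :
    ∃ x, HasValidCommit ((E.config k i).inbox j) v x := by
  obtain ⟨x, hx⟩ := (h.follows.localInv hj _).commit v (hr j hj)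
  have h1 := (h.follows.inbox_prefix i hk j).subset (h.delivered_mem hT hj hi hx)
  have h2 : Ordered ((E.config k i).inbox j) :=
    (h.follows.localInv hj k).ordered.sublist
      (h.broadcast.inbox_prefix_out hj hi k).sublist
  exact ⟨x, h2.hasValidCommit h1⟩

/-- The summand `Δ` before `τ v` covers the delivery of the commits. For the senders that stay
silent, the wait ends by the timeout. -/
theorem pass_waitCommit (h : E.Timely f τ input correct clock Δ G)
    (hcard : n - f ≤ correct.card) (hT : G ≤ T) (hτ : 0 ≤ τ v)
    (hr : ∀ i ∈ correct, 4 * v + 2 ≤ (E.stateAt T i).rank) :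
    ∀ i ∈ correct, 4 * v + 3 ≤ (E.stateAt (T + Δ + τ v + Δ) i).rank := by
  intro i hi
  have hΔ := h.delay_nonneg
  have hT1 : G ≤ T + Δ := by linarith
  have hT' : T + Δ ≤ T + Δ + τ v := by linarith
  have hr1 := (hr i hi).trans (h.rank_mono i hT (T' := T + Δ) (by linarith))
  refine h.progress hi (hT1.trans hT') (hr1.trans (h.rank_mono i hT1 hT')) fun heq => ?_
  obtain ⟨hp, hv⟩ := ((E.stateAt (T + Δ + τ v) i).rank_eq_iff v).2.2.1.1 heq
  have hex := h.expired hi hT1 hr1 heq (Or.inr hp) hτ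
  simp only [LocalState.MainStep, hp]
  refine ⟨_, ⟨⟨correct, hcard, fun j hj => ?_⟩, fun j => Or.inr ?_⟩, rfl⟩
  · rw [hv]
    exact h.validCommit_delivered hT hr hi hj (h.follows.last_mono (h.start_le.trans hT1) hT')
  · rw [hv]
    exact hex

/-- The view changes of the correct processes, with the acknowledgements of the correct processes,
let every correct process enter the next view. -/
theorem pass_waitViewChange (h : E.Timely f τ input correct clock Δ G)
    (hcard : n - f ≤ correct.card) (hT : G ≤ T)
    (hr : ∀ i ∈ correct, 4 * v + 3 ≤ (E.stateAt T i).rank) :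
    ∀ i ∈ correct, 4 * (v + 1) ≤ (E.stateAt (T + Δ + Δ + Δ + Δ) i).rank := by
  intro i hi
  have hΔ := h.delay_nonneg
  have h0 := h.start_le.trans hT
  have hT' : T ≤ T + Δ + Δ + Δ := by linarith
  have hvc : ∀ j : Fin n, ∃ (a : ℕ) (d : ViewChange n V), j ∈ correct →
      ViewChangeValid n f j (E.stateAt T j).out a d ∧ d.view = v + 1 := by
    intro j
    by_cases hj : j ∈ correct
    · obtain ⟨a, d, hd⟩ := (h.follows.localInv hj _).viewChange v (hr j hj)
      exact ⟨a, d, fun _ => hd⟩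
    · exact ⟨0, ⟨j, 0, 0, none, []⟩, fun hj' => absurd hj' hj⟩
  choose a d hd using hvc
  -- An acknowledgement by the sender itself does not count, but there are at least `n - f - 1` other
  -- correct processes.
  set P : List (Certificate n V) :=
    correct.toList.map fun j => (d j, (correct.erase j).toList) with hPdef
  have hmem : ∀ c ∈ P, ∃ j ∈ correct, c = (d j, (correct.erase j).toList) := by
    intro c hc
    obtain ⟨j, hj, rfl⟩ := List.mem_map.1 hc
    exact ⟨j, Finset.mem_toList.1 hj, rfl⟩
  have hsender : ∀ j ∈ correct, (d j).sender = j := fun j hj => (hd j hj).1.2.1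
  have hproof : ViewChangeProof n f (v + 1) P := by
    refine ⟨by simpa [hPdef] using hcard, ?_, fun c hc => ?_, fun c hc c' hc' => ?_⟩
    · have : P.map (fun c => c.1.sender) = correct.toList := by
        rw [hPdef, List.map_map]
        conv_rhs => rw [← List.map_id correct.toList]
        exact List.map_congr_left fun j hj => hsender j (Finset.mem_toList.1 hj)
      rw [this]
      exact Finset.nodup_toList _
    · obtain ⟨j, hj, rfl⟩ := hmem c hc
      refine ⟨(hd j hj).2, Finset.nodup_toList _, ?_, ?_⟩
      · simp [hsender j hj]
      · simp only [Finset.length_toList, Finset.card_erase_of_mem hj]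
        omega
    · obtain ⟨j, hj, rfl⟩ := hmem c hc
      obtain ⟨j', hj', rfl⟩ := hmem c' hc'
      exact h.not_conflict hj hj' (hd j hj).1 (hd j' hj').1 _
  have hrec : ∀ c ∈ P, (E.stateAt (T + Δ + Δ + Δ) i).ReceivedCert c := by
    intro c hc
    obtain ⟨j, hj, rfl⟩ := hmem c hc
    refine ⟨?_, fun q hq => ?_⟩
    · simp only [hsender j hj]
      have h1 := h.delivered_mem hT hj hi (List.mem_of_getElem? (hd j hj).1.1)
      exact (h.follows.inbox_prefix i
        (h.follows.last_mono (T := T + Δ) (by linarith) (by linarith)) j).subset h1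
    · have hq' := Finset.mem_of_mem_erase (Finset.mem_toList.1 hq)
      exact h.delivered_mem (T := T + Δ + Δ) (by linarith) hq' hi
        (h.acknowledged hT hq' hj (hd j hj).1)
  refine h.progress (r := 4 * v + 3) hi (hT.trans hT')
    ((hr i hi).trans (h.rank_mono i hT hT')) fun heq => ?_
  obtain ⟨hp, hv⟩ := ((E.stateAt (T + Δ + Δ + Δ) i).rank_eq_iff v).2.2.2.1 heq
  obtain ⟨e, he⟩ := exists_estimate P
  simp only [LocalState.MainStep, hp]
  exact ⟨_, P, e, by rw [hv]; exact hproof, hrec, he, rfl⟩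

theorem pass_view (h : E.Timely f τ input correct clock Δ G) (hcard : n - f ≤ correct.card)
    (hT : G ≤ T) (hτ : 0 ≤ τ v) (hr : ∀ i ∈ correct, 4 * v ≤ (E.stateAt T i).rank) :
    ∀ i ∈ correct, 4 * (v + 1) ≤ (E.stateAt (T + (2 * τ v + 8 * Δ)) i).rank := by
  have hΔ := h.delay_nonneg
  have h1 := h.pass_top hT hr
  have h2 := h.pass_waitPrepare (by linarith) hτ h1
  have h3 := h.pass_waitCommit hcard (by linarith) hτ h2
  have h4 := h.pass_waitViewChange hcard (by linarith) h3
  have h5 : T + (2 * τ v + 8 * Δ) =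
      T + Δ + τ v + Δ + Δ + τ v + Δ + Δ + Δ + Δ + Δ := by ring
  rwa [h5]

/-! ### A view in which every correct process decides -/

section GoodView

variable {p : Fin n}

/-- In a view with a correct primary whose timeout is long enough, every correct process commits the
estimate of the primary. -/
theorem commit_eq (h : E.Timely f τ input correct clock Δ G) (hT : G ≤ T) (hp : p ∈ correct)
    (hpv : p.val = v % n) (hτ : T + Δ < G + τ v)
    (hG : ∀ i ∈ correct, (E.stateAt G i).rank < 4 * v) {a : ℕ} {x : V}
    {P : List (Certificate n V)}
    (hx : FirstValidPrepare n f (E.stateAt T p).out v a x P) {i : Fin n} (hi : i ∈ correct)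
    (k : ℕ) {y : Option V} (hy : .commit v y ∈ (E.config k i).out) : y = some x := by
  induction k with
  | zero => rw [h.follows.start i hi] at hy; simp [LocalState.initial] at hy
  | succ k ih =>
    rcases h.follows.step_cases i k with hk | ⟨q, m, hk⟩ | ⟨j, a, d, hd, hk⟩ | hk
    · rw [hk] at hy; exact ih hy
    · rw [hk] at hy; exact ih hy
    · rw [hk] at hy; exact ih (by simpa using hy)
    · rcases hk.commit_mem hy with hy | ⟨hph, hv, ⟨y', Q, hQ, rfl⟩ | ⟨hacc, hex⟩⟩
      · exact ih hy
      · obtain ⟨q, hq, b, hb⟩ := hQ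
        rw [hv] at hq hb
        obtain rfl : q = p := by ext; rw [hq, hpv]
        congr 1
        refine hb.unique hx fun c m m' hm hm' => ?_
        have h1 := h.broadcast.integrity q hp i hi _ _ _ hm
        simp only [stateAt] at hm'
        rcases le_total (E.last T) k with hle | hle
        · rw [getElem?_of_prefix (h.follows.out_prefix q hle) hm'] at h1
          exact (Option.some.inj h1).symm
        · rw [getElem?_of_prefix (h.follows.out_prefix q hle) h1] at hm'
          exact Option.some.inj hm'
      · -- When the timeout expires, the proposal of `p` has been delivered and can be accepted.
        exfalso
        have hrk : (E.config k i).rank = 4 * v + 1 :=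
          ((E.config k i).rank_eq_iff v).2.1.2 ⟨hph, hv⟩
        rw [hv] at hex
        have h1 := h.le_time_of_expired hi (by have := hG i hi; omega) (Or.inl hph) hex
        have hΔ := h.delay_nonneg
        have h2 : E.last (T + Δ) ≤ k :=
          h.follows.last_le (by linarith [h.start_le]) (by linarith)
        have h3 := getElem?_of_prefix (h.follows.inbox_prefix i h2 p) (h.delivered hT hp hi hx.1)
        have h4 : T ≤ T + Δ := by linarith
        have h5 := hx.of_prefix (h.follows.out_prefix p
          ((h.follows.last_mono (h.start_le.trans hT) h4).trans h2))
        refine hacc ⟨x, P, p, by rw [hv, hpv], a, ?_⟩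
        rw [hv]
        exact h5.congr fun b hb =>
          (getElem?_eq_of_prefix (h.broadcast.inbox_prefix_out hp hi _) h3 hb).symm

/-- In a view with a correct primary whose timeout is long enough, every correct process decides
when it leaves the second wait: by then it has received the commits of all correct processes. -/
theorem decision_ne_none (h : E.Timely f τ input correct clock Δ G)
    (hcard : n - f ≤ correct.card) (hT : G ≤ T) (hp : p ∈ correct) (hpv : p.val = v % n)
    (hτ : T + 4 * Δ < G + τ v) (hG : ∀ i ∈ correct, (E.stateAt G i).rank < 4 * v)
    (hr : ∀ i ∈ correct, 4 * v ≤ (E.stateAt T i).rank) {i : Fin n} (hi : i ∈ correct) (k : ℕ)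
    (hk : 4 * v + 3 ≤ (E.config k i).rank) : (E.config k i).decision ≠ none := by
  have hΔ := h.delay_nonneg
  have hT1 : G ≤ T + Δ := by linarith
  have hr1 := h.pass_top hT hr
  obtain ⟨a, x, P, hx⟩ := (h.follows.localInv hp _).prepare v (hr1 p hp) hpv
  -- No correct process commits anything but `x` in view `v`.
  have hcommit : ∀ j ∈ correct, ∀ k y, .commit v y ∈ (E.config k j).out → y = some x :=
    fun j hj k y => h.commit_eq hT1 hp hpv (by linarith) hG hx hj k
  -- All have committed well before a timeout can expire, as the proposal arrives by `T + 2 * Δ`.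
  have hr2 : ∀ j ∈ correct, 4 * v + 2 ≤ (E.stateAt (T + Δ + Δ + Δ) j).rank := by
    intro j hj
    have hT2 : T + Δ ≤ T + Δ + Δ := by linarith
    refine h.progress hj (hT1.trans hT2) ((hr1 j hj).trans (h.rank_mono j hT1 hT2)) fun heq => ?_
    obtain ⟨hph, hv⟩ := ((E.stateAt (T + Δ + Δ) j).rank_eq_iff v).2.1.1 heq
    have h3 := h.delivered hT1 hp hj hx.1
    have h5 := hx.of_prefix (h.follows.out_prefix p
      (h.follows.last_mono (h.start_le.trans hT1) hT2))
    have hacc : (E.stateAt (T + Δ + Δ) j).Accepts f x P := by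
      refine ⟨p, by rw [hv, hpv], a, ?_⟩
      rw [hv]
      exact h5.congr fun b hb =>
        (getElem?_eq_of_prefix (h.broadcast.inbox_prefix_out hp hj _) h3 hb).symm
    simp only [LocalState.MainStep, hph]
    exact ⟨_, Or.inl ⟨x, P, hacc, rfl⟩⟩
  induction k with
  | zero =>
    rw [h.follows.start i hi] at hk
    simp [LocalState.initial, LocalState.rank, Phase.index] at hk
  | succ k ih =>
    rcases h.follows.step_cases i k with hs | ⟨q, m, hs⟩ | ⟨j, a, d, hd, hs⟩ | hs
    · rw [hs] at hk ⊢; exact ih hk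
    · rw [hs] at hk ⊢; exact ih hk
    · rw [hs] at hk ⊢; exact ih hk
    · by_cases hold : 4 * v + 3 ≤ (E.config k i).rank
      · exact hs.decision_ne_none (ih hold)
      have hrk : (E.config k i).rank = 4 * v + 2 := by
        have := hs.rank_eq
        omega
      obtain ⟨hph, hv⟩ := ((E.config k i).rank_eq_iff v).2.2.1.1 hrk
      have haux : (E.config k i).aux = some x := by
        refine hcommit i hi k _ ?_
        have := (h.follows.localInv hi k).commit_aux (by simp [hph, Phase.index])
        rwa [hv] at this
      simp only [LocalState.MainStep, hph] at hs
      obtain ⟨⟨-, hall⟩, hs⟩ := hs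
      -- commits of all correct processes have arrived.
      have hquorum : (E.config k i).CommitQuorum f := by
        refine ⟨correct, hcard, fun j hj => ?_⟩
        have hsome : ∃ y, HasValidCommit ((E.config k i).inbox j) v y := by
          rcases hall j with hj' | hex
          · rwa [hv] at hj'
          · rw [hv] at hex
            have h1 := h.le_time_of_expired hi (by have := hG i hi; omega) (Or.inr hph) hex
            exact h.validCommit_delivered (T := T + Δ + Δ + Δ) (by linarith) hr2 hi hj
              (h.follows.last_le (by linarith [h.start_le]) (by linarith))
        obtain ⟨y, hy⟩ := hsome
        obtain rfl := hcommit j hj k y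
          ((h.broadcast.inbox_prefix_out hj hi k).subset hy.mem)
        rwa [hv, haux]
      rw [hs]
      simp only [LocalState.decide, if_pos hquorum, haux]
      cases (E.config k i).decision <;> simp

end GoodView

end Timely

end Execution

/-! ### The timeouts -/

/-- The timeouts grow so fast that `timeout Δ v` exceeds by `5 * Δ` the time that the correct
processes need for all views before `v`, at `2 * timeout Δ u + 8 * Δ` for view `u`. -/
noncomputable def timeout (Δ : ℝ) (v : ℕ) : ℝ := (9 * 3 ^ v - 4) * Δ

theorem timeout_nonneg {Δ : ℝ} (hΔ : 0 ≤ Δ) (v : ℕ) : 0 ≤ timeout Δ v := by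
  have : (1 : ℝ) ≤ 3 ^ v := one_le_pow₀ (by norm_num)
  exact mul_nonneg (by linarith) hΔ

theorem Execution.Timely.enter_view {E : Execution n V} {input : Fin n → V}
    {correct : Finset (Fin n)} {clock : Fin n → ℝ → ℝ} {Δ G : ℝ}
    (h : E.Timely f (timeout Δ) input correct clock Δ G) (hcard : n - f ≤ correct.card) (v : ℕ) :
    ∀ i ∈ correct, 4 * v ≤ (E.stateAt (G + 9 * (3 ^ v - 1) * Δ) i).rank := by
  induction v with
  | zero => simp
  | succ v ih =>
    have h1 : (1 : ℝ) ≤ 3 ^ v := one_le_pow₀ (by norm_num)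
    have h2 : 0 ≤ 9 * ((3 : ℝ) ^ v - 1) * Δ := mul_nonneg (by linarith) h.delay_nonneg
    have h3 := h.pass_view hcard (by linarith) (timeout_nonneg h.delay_nonneg v) ih
    have h4 : G + 9 * (3 ^ (v + 1) - 1) * Δ =
        G + 9 * (3 ^ v - 1) * Δ + (2 * timeout Δ v + 8 * Δ) := by rw [timeout]; ring
    rwa [h4]

end CBConsensus

theorem mainTheorem6 (n f : ℕ) (hn : n = 2 * f + 1) (Δ : ℝ) (hΔ : 0 < Δ) :
    ∃ τ : ℕ → ℝ, ∀ (V : Type*) (input : Fin n → V) (correct : Finset (Fin n)),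
      n - f ≤ correct.card →
      ∀ (clock : Fin n → ℝ → ℝ) (E : CBConsensus.Execution n V),
        E.Follows f τ input correct clock →
        E.ConsistentBroadcast correct →
        E.Unforgeable correct →
        (∃ gst : ℝ, E.SynchronousAfter f τ input correct clock Δ gst) →
        ∀ i ∈ correct, ∃ k, (E.config k i).decision ≠ none := by
  refine ⟨CBConsensus.timeout Δ, ?_⟩
  rintro V input correct hcard clock E hfol hcb - ⟨gst, hsync⟩ i hi
  set G := max gst (E.time 0)
  have h : E.Timely f (CBConsensus.timeout Δ) input correct clock Δ G :=
    ⟨hfol, hcb, hsync.mono (le_max_left _ _), le_max_right _ _, hΔ.le⟩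
  obtain ⟨p, hp⟩ : correct.Nonempty := Finset.card_pos.1 (by omega)
  -- A view with the correct primary `p` that no process has entered by time `G`.
  obtain ⟨v, hpv, hG⟩ : ∃ v, p.val = v % n ∧ ∀ j ∈ correct, (E.stateAt G j).rank < 4 * v := by
    refine ⟨n * (Finset.univ.sup (fun j => (E.stateAt G j).rank) + 1) + p.val, ?_, fun j _ => ?_⟩
    · rw [Nat.mul_add_mod, Nat.mod_eq_of_lt p.isLt]
    · have h1 : (E.stateAt G j).rank ≤ Finset.univ.sup (fun j => (E.stateAt G j).rank) :=
        Finset.le_sup (f := fun j => (E.stateAt G j).rank) (Finset.mem_univ j)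
      have h2 := Nat.le_mul_of_pos_left
        (Finset.univ.sup (fun j => (E.stateAt G j).rank) + 1) (show 0 < n by omega)
      omega
  have h1 : (1 : ℝ) ≤ 3 ^ v := one_le_pow₀ (by norm_num)
  have h2 : 0 ≤ 9 * ((3 : ℝ) ^ v - 1) * Δ := mul_nonneg (by linarith) hΔ.le
  refine ⟨_, h.decision_ne_none hcard (le_add_of_nonneg_right h2) hp hpv ?_ hG
    (h.enter_view hcard v) hi _ (le_trans ?_ (h.enter_view hcard (v + 1) i hi))⟩
  · rw [CBConsensus.timeout]
    linarith
  · omega
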